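/- **Proposition.** Digraphs are finite and may have loops, parallel arcs and several components. A digraph is *quartic Eulerian* if every vertex has in-degree $2$ and out-degree $2$. A digraph is *diplanar* if its underlying graph has an embedding in the plane such that in- and out-edges alternate in the rotation at each vertex; embeddings are described combinatorially, that is, there is a rotation system (a cyclic order of the half-edges at each vertex) which alternates between in- and out-edges at each vertex and has genus $0$, meaning $|V|-|E|+|F|=2c$, where $c$ is the number of connected components and $|F|$ is the number of facial walks (with one trivial facial walk for each isolated vertex). For quartic Eulerian digraphs $G,H$ write $H\prec G$ if $H$ is, up to isomorphism, obtained from $G$ by one or more steps, each of which removes the arcs of a directed cycle, deletes an isolated vertex, or suppresses a vertex $v$ with exactly one in-arc $uv$ and exactly one out-arc $vw$, these being distinct arcs (replacing them by a single arc $uw$). A *diplanar obstruction* is a quartic Eulerian digraph $G$ that is not diplanar, while every quartic Eulerian digraph $H\prec G$ is diplanar. Let $n=2k+1\ge 5$ be odd and let $Z_n$ be the Cayley digraph of the cyclic group $\mathbb Z/n\mathbb Z$ with generating set $\{1,k\}$, i.e. with arcs $g\to g+1$ and $g\to g+k$ for all $g\in\mathbb Z/n\mathbb Z$. Then $Z_n$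 is a diplanar obstruction. Moreover, for every directed cycle $C$ of $Z_n$, the digraph $Z_n-E(C)$ is diplanar. -/

import Mathlib

/-- Finite directed multigraphs: loops and parallel arcs are allowed, connectedness is not
required. The arc `e` goes from `src e` to `tgt e`. -/
structure MultiDigraph where
  V : Type
  E : Type
  finV : Finite V
  finE : Finite E
  src : E → V
  tgt : E → V

namespace MultiDigraph

attribute [instance] MultiDigraph.finV MultiDigraph.finE

/-- The in-degree of a vertex (a loop counts once). -/
noncomputable def inDegree (G : MultiDigraph) (v : G.V) : ℕ := {e : G.E | G.tgt e = v}.ncard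

/-- The out-degree of a vertex (a loop counts once). -/
noncomputable def outDegree (G : MultiDigraph) (v : G.V) : ℕ := {e : G.E | G.src e = v}.ncard

/-- Quartic Eulerian digraphs: in-degree and out-degree are equal to 2 at every vertex. -/
def IsQuarticEulerian (G : MultiDigraph) : Prop :=
  ∀ v : G.V, G.inDegree v = 2 ∧ G.outDegree v = 2

/-- A vertex is isolated if no arc starts or ends at it. -/
def IsIsolated (G : MultiDigraph) (v : G.V) : Prop :=
  ∀ e : G.E, G.src e ≠ v ∧ G.tgt e ≠ v

/-- `C` is the arc set of a directed cycle of length `m + 1`: the arcs `c 0, …, c m` are consecutive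
(indices are added modulo `m + 1`) and start at distinct vertices. A loop is a cycle of length 1. -/
def IsDirectedCycle (G : MultiDigraph) (C : Set G.E) : Prop :=
  ∃ (m : ℕ) (c : Fin (m + 1) → G.E),
    (Function.Injective fun i => G.src (c i)) ∧
    (∀ i, G.tgt (c i) = G.src (c (i + 1))) ∧
    C = Set.range c

/-- The digraph `G - C` on the same vertices, for a set `C` of arcs. -/
def deleteArcs (G : MultiDigraph) (C : Set G.E) : MultiDigraph where
  V := G.V
  E := {e : G.E // e ∉ C}
  finV := inferInstance
  finE := inferInstance
  src e := G.src e.1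
  tgt e := G.tgt e.1

/-! ### Embeddings in the plane -/

/-- The half-arcs of `G`: `(e, true)` is the half of `e` at its source (an out-edge there), and
`(e, false)` is the half of `e` at its target (an in-edge there). -/
abbrev Dart (G : MultiDigraph) : Type := G.E × Bool

/-- The vertex at which a half-arc is attached. -/
def dartVertex (G : MultiDigraph) (d : G.Dart) : G.V :=
  if d.2 then G.src d.1 else G.tgt d.1

/-- The involution that exchanges the two halves of every arc. -/
def dartRev (G : MultiDigraph) : Equiv.Perm G.Dart where
  toFun d := (d.1, !d.2)
  invFun d := (d.1, !d.2)
  left_inv d := by simp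
  right_inv d := by simp

/-- A rotation system of the underlying graph: a cyclic ordering of the half-arcs at each vertex.
The cycles of the permutation `rot` are exactly the sets of half-arcs at the
(non-isolated) vertices. -/
structure RotationSystem (G : MultiDigraph) where
  rot : Equiv.Perm G.Dart
  sameCycle_iff : ∀ d d' : G.Dart, rot.SameCycle d d' ↔ G.dartVertex d = G.dartVertex d'

/-- In- and out-edges alternate in the rotation at each vertex. -/
def RotationSystem.IsAlternating {G : MultiDigraph} (R : G.RotationSystem) : Prop :=
  ∀ d : G.Dart, (R.rot d).2 = !d.2

/-- Face tracing: walk along an arc to its other end, then continue with the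
next half-arc in the rotation at that vertex. -/
def RotationSystem.facePerm {G : MultiDigraph} (R : G.RotationSystem) : Equiv.Perm G.Dart :=
  R.rot * G.dartRev

/-- The number of facial walks: the cycles (including fixed points) of the face tracing
permutation, and one trivial facial walk for each isolated vertex. -/
noncomputable def RotationSystem.numFaces {G : MultiDigraph} (R : G.RotationSystem) : ℕ :=
  Nat.card (Quotient (Equiv.Perm.SameCycle.setoid R.facePerm)) + {v : G.V | G.IsIsolated v}.ncard

/-- The number of connected components of the underlying graph. `Quot` is the quotient by the
equivalence relation generated by adjacency. -/
noncomputable def numComponents (G : MultiDigraph) : ℕ :=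
  Nat.card (Quot fun u v : G.V => ∃ e : G.E, G.src e = u ∧ G.tgt e = v)

/-- The rotation system has genus zero, that is, it is the rotation system of an embedding in the
plane: `|V| - |E| + |F| = 2 c`, where `c` is the number of components. A component of genus `g`
contributes `2 - 2 g` to the left side, so the equation says that every component has genus 0. -/
def RotationSystem.IsPlanar {G : MultiDigraph} (R : G.RotationSystem) : Prop :=
  Nat.card G.V + R.numFaces = Nat.card G.E + 2 * G.numComponents

/-- A digraph is diplanar if it has an embedding in the plane such that in- and out-edges
alternate in the rotation at each vertex. -/
def IsDiplanar (G : MultiDigraph) : Prop :=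
  ∃ R : G.RotationSystem, R.IsAlternating ∧ R.IsPlanar

/-! ### The order on quartic Eulerian digraphs -/

/-- `H` is (up to isomorphism) obtained from `G` by removing the arcs of a directed cycle. -/
def RemovesCycle (G H : MultiDigraph) : Prop :=
  ∃ (C : Set G.E) (fV : H.V ≃ G.V) (fE : H.E → G.E),
    G.IsDirectedCycle C ∧ Function.Injective fE ∧ Set.range fE = Cᶜ ∧
    (∀ a, fV (H.src a) = G.src (fE a)) ∧ (∀ a, fV (H.tgt a) = G.tgt (fE a))

/-- `H` is (up to isomorphism) obtained from `G` by deleting an isolated vertex. -/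
def DeletesIsolated (G H : MultiDigraph) : Prop :=
  ∃ (v : G.V) (fV : H.V → G.V) (fE : H.E ≃ G.E),
    G.IsIsolated v ∧ Function.Injective fV ∧ Set.range fV = {v}ᶜ ∧
    (∀ a, fV (H.src a) = G.src (fE a)) ∧ (∀ a, fV (H.tgt a) = G.tgt (fE a))

open Classical in
/-- `H` is (up to isomorphism) obtained from `G` by suppressing a vertex `v` of degree 2, whose only
in-arc `e = uv` and only out-arc `f = vw` are distinct: `v` and `f` are deleted, and
`e` becomes an arc `uw`. -/
def SuppressesVertex (G H : MultiDigraph) : Prop :=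
  ∃ (v : G.V) (e f : G.E) (fV : H.V → G.V) (fE : H.E → G.E),
    e ≠ f ∧ (∀ a, G.tgt a = v ↔ a = e) ∧ (∀ a, G.src a = v ↔ a = f) ∧
    Function.Injective fV ∧ Set.range fV = {v}ᶜ ∧
    Function.Injective fE ∧ Set.range fE = {f}ᶜ ∧
    (∀ a, fV (H.src a) = G.src (fE a)) ∧
    (∀ a, fV (H.tgt a) = if fE a = e then G.tgt f else G.tgt (fE a))

/-- One reduction step. -/
def Reduces (G H : MultiDigraph) : Prop :=
  G.RemovesCycle H ∨ G.DeletesIsolated H ∨ G.SuppressesVertex H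

/-- `H` is strictly smaller than `G`: it is obtained from `G` by one or more reduction steps. Each
step decreases the number of vertices plus arcs, and the first step out of a
quartic Eulerian digraph is the removal of a directed cycle. -/
def StrictlySmaller (H G : MultiDigraph) : Prop := Relation.TransGen Reduces G H

/-- A diplanar obstruction: a quartic Eulerian digraph that is not diplanar, while every strictly
smaller quartic Eulerian digraph is. -/
def IsDiplanarObstruction (G : MultiDigraph) : Prop :=
  G.IsQuarticEulerian ∧ ¬ G.IsDiplanar ∧
    ∀ H : MultiDigraph, H.IsQuarticEulerian → H.StrictlySmaller G → H.IsDiplanar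

/-- The Cayley digraph of a finite additive group with connection set `S`: an arc from `g` to
`g + s` for every `g` in the group and every `s ∈ S`. -/
def cayley (A : Type) [AddGroup A] [Finite A] (S : Set A) : MultiDigraph where
  V := A
  E := A × S
  finV := inferInstance
  finE := inferInstance
  src a := a.1
  tgt a := a.1 + a.2

end MultiDigraph

/-! An alternating rotation system amounts to two permutations `p`, `q` of the arcs, each sending an
arc to one that leaves its head. The facial walks are the cycles of `p` (one orientation) and of `q`
(the other), and the cycles of `q⁻¹ * p` are the sets of arcs with a common head. Planarity thus
says that the hypermap `(p, q)` has genus zero (`isDiplanar_iff`), and every facial walk is a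
directed closed walk.

Since `2k = -1` modulo `n`, multiplication by 2 turns `Z_n` into `stepDigraph n`, with arcs `m → m +
2` and `m → m - 1`. A plane embedding would need at least `n + 2` facial walks. Closed walks have
length at least 3 because `n ≥ 5`. The walks of one orientation use every arc once, with total
displacement `2n - n = n`; so one of them has positive displacement, a multiple of `n`, and as `n`
is odd its length is at least `(n + 3) / 2`. This leaves room for at most `(n + 1) / 2` walks per
orientation (`two_mul_cycleCount_le`), hence `n + 1` in all.

For a directed cycle `C`, the net number of crossings of the cut between `m` and `m + 1` is a
constant `t` with `-1 ≤ t ≤ 2`. If `t` is `-1` or `2`, then `C` contains all arcs of one type and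
visits every vertex, so the rest is a disjoint union of cycles. If `t = 0`, then `C` is a triangle
`i → i + 2 → i + 1 → i`, and an embedding of the rest is given explicitly. If `t = 1`, the rest
splits into triangles that are digons up to suppression and bound faces.

Smaller digraphs are covered because each reduction step preserves diplanarity: removing a cycle
amounts to splitting vertices, which does not increase the genus (`genus_mul_swap_le`), followed by
restriction to an invariant set of arcs. So only the removal of one cycle from `Z_n` itself has to
be examined. -/

open Equiv Equiv.Perm

/-- The number of cycles of a permutation, fixed points included. -/
noncomputable def cycleCount {X : Type*} (p : Perm X) : ℕ :=
  Nat.card (Quotient (SameCycle.setoid p))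

/-- The number of orbits of the group generated by two permutations. -/
noncomputable def orbitCount {X : Type*} (p q : Perm X) : ℕ :=
  Nat.card (Quot fun x y : X => y = p x ∨ y = q x)

/-- The pair `(p, q)` is a hypermap of genus zero. The reverse inequality always holds, see
`cycleCount_add_le`. -/
def IsSpherical {X : Type*} (p q : Perm X) : Prop :=
  Nat.card X + 2 * orbitCount p q ≤ cycleCount p + cycleCount q + cycleCount (q⁻¹ * p)

/-! ### Counting cycles and orbits by invariant labels -/

section Counting

variable {X : Type*}

theorem Equiv.Perm.SameCycle.eq_of_invariant {β : Type*} {p : Perm X} {f : X → β}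
    (hf : ∀ x, f (p x) = f x) {x y : X} (h : p.SameCycle x y) : f x = f y := by
  have hn : ∀ (n : ℕ) (x : X), f ((p ^ n) x) = f x := by
    intro n
    induction n with
    | zero => simp
    | succ n ih => intro x; rw [pow_succ, Perm.mul_apply, ih, hf]
  obtain ⟨i, rfl⟩ := h
  obtain ⟨n, rfl | rfl⟩ := i.eq_nat_or_neg
  · rw [zpow_natCast, hn]
  · rw [zpow_neg, zpow_natCast]
    simpa using hn n ((p ^ n)⁻¹ x)

theorem ncard_range_le_card_quot [Finite X] {β : Type*} {r : X → X → Prop} (f : X → β)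
    (hf : ∀ x y, r x y → f x = f y) : (Set.range f).ncard ≤ Nat.card (Quot r) := by
  have : Set.range f = Set.range (Quot.lift f hf) := by
    ext b; constructor
    · rintro ⟨x, rfl⟩; exact ⟨Quot.mk _ x, rfl⟩
    · rintro ⟨⟨x⟩, rfl⟩; exact ⟨x, rfl⟩
  rw [this, ← Set.image_univ, ← Set.ncard_univ]
  exact Set.ncard_image_le

/-- The source of all lower bounds on numbers of facial walks: it is enough to label the arcs
invariantly and to count the labels that occur. -/
theorem ncard_range_le_cycleCount [Finite X] {β : Type*} {p : Perm X} (f : X → β)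
    (hf : ∀ x, f (p x) = f x) : (Set.range f).ncard ≤ cycleCount p :=
  ncard_range_le_card_quot f fun _ _ h => SameCycle.eq_of_invariant hf h

theorem ncard_range_le_orbitCount [Finite X] {β : Type*} {p q : Perm X} (f : X → β)
    (hp : ∀ x, f (p x) = f x) (hq : ∀ x, f (q x) = f x) :
    (Set.range f).ncard ≤ orbitCount p q := by
  refine ncard_range_le_card_quot f ?_
  rintro x y (rfl | rfl)
  · exact (hp x).symm
  · exact (hq x).symm

/-- The cycle of a point. -/
def cycleClass (p : Perm X) (x : X) : Quotient (SameCycle.setoid p) := Quotient.mk _ x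

theorem cycleClass_eq {p : Perm X} {x y : X} :
    cycleClass p x = cycleClass p y ↔ p.SameCycle x y := Quotient.eq

theorem cycleClass_apply (p : Perm X) (x : X) : cycleClass p (p x) = cycleClass p x :=
  cycleClass_eq.2 (SameCycle.refl p x).apply_left

theorem cycleClass_surjective (p : Perm X) : Function.Surjective (cycleClass p) :=
  Quotient.mk_surjective

/-- The orbit of a point. -/
def orbitClass (p q : Perm X) (x : X) : Quot fun x y : X => y = p x ∨ y = q x := Quot.mk _ x

theorem orbitClass_left (p q : Perm X) (x : X) : orbitClass p q (p x) = orbitClass p q x :=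
  (Quot.sound (r := fun x y : X => y = p x ∨ y = q x) (Or.inl rfl)).symm

theorem orbitClass_right (p q : Perm X) (x : X) : orbitClass p q (q x) = orbitClass p q x :=
  (Quot.sound (r := fun x y : X => y = p x ∨ y = q x) (Or.inr rfl)).symm

theorem orbitClass_surjective (p q : Perm X) : Function.Surjective (orbitClass p q) :=
  Quot.mk_surjective

theorem ncard_range_of_surjective {Y : Type*} {f : X → Y} (hf : Function.Surjective f) :
    (Set.range f).ncard = Nat.card Y := by
  rw [hf.range_eq, Set.ncard_univ]

theorem orbitCount_comm (p q : Perm X) : orbitCount p q = orbitCount q p := by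
  unfold orbitCount
  congr 2
  ext x y
  exact or_comm

theorem cycleCount_inv (p : Perm X) : cycleCount p⁻¹ = cycleCount p := by
  have : SameCycle.setoid p⁻¹ = SameCycle.setoid p := by
    ext x y
    exact sameCycle_inv
  simp only [cycleCount, this]

theorem cycleCount_le_card [Finite X] (p : Perm X) : cycleCount p ≤ Nat.card X :=
  Nat.card_le_card_of_surjective _ (cycleClass_surjective p)

theorem orbitCount_le_cycleCount_right [Finite X] (p q : Perm X) :
    orbitCount p q ≤ cycleCount q := by
  rw [orbitCount, ← ncard_range_of_surjective (orbitClass_surjective p q)]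
  exact ncard_range_le_cycleCount _ (orbitClass_right p q)

theorem IsSpherical.symm {p q : Perm X} (h : IsSpherical p q) : IsSpherical q p := by
  unfold IsSpherical at *
  rw [orbitCount_comm q p, show p⁻¹ * q = (q⁻¹ * p)⁻¹ by group, cycleCount_inv]
  omega

end Counting

/-! ### Multiplication by a transposition, and its effect on the genus -/

section Swap

variable {X : Type*}

/-- Identifying two values of a function loses at most one value. -/
theorem exists_merge [Finite X] {β : Type*} (f : X → β) (a b : X) :
    ∃ g : X → β, (∀ x y, f x = f y → g x = g y) ∧ g a = g b ∧
      (Set.range f).ncard ≤ (Set.range g).ncard + 1 := by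
  classical
  refine ⟨fun x => if f x = f b then f a else f x, fun x y h => by simp only [h], by simp, ?_⟩
  have hsub : Set.range f ⊆ insert (f b) (Set.range fun x => if f x = f b then f a else f x) := by
    rintro _ ⟨x, rfl⟩
    by_cases h : f x = f b
    · exact Or.inl h
    · exact Or.inr ⟨x, by simp [h]⟩
  exact (Set.ncard_le_ncard hsub ((Set.finite_range _).insert _)).trans (Set.ncard_insert_le _ _)

variable [DecidableEq X]

theorem apply_swap_of_eq {β : Type*} {f : X → β} {a b : X} (h : f a = f b) (x : X) :
    f (swap a b x) = f x := by
  by_cases ha : x = a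
  · subst ha; simp [h]
  by_cases hb : x = b
  · subst hb; simp [h]
  rw [swap_apply_of_ne_of_ne ha hb]

/-- Once the labels of `a` and `b` are identified, the cycles of the product label the points
invariantly under `p`; the identification costs one label. -/
theorem cycleCount_mul_swap_le_add_one [Finite X] (p : Perm X) (a b : X) :
    cycleCount (p * swap a b) ≤ cycleCount p + 1 := by
  set r := p * swap a b with hr
  have hp : ∀ x, p x = r (swap a b x) := fun x => by simp [hr]
  obtain ⟨g, hg, hab, hle⟩ := exists_merge (cycleClass r) a b
  rw [cycleCount, ← ncard_range_of_surjective (cycleClass_surjective r)]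
  refine hle.trans (Nat.add_le_add_right (ncard_range_le_cycleCount g fun x => ?_) 1)
  rw [hp, hg _ _ (cycleClass_apply r _), apply_swap_of_eq hab]

theorem orbitCount_mul_swap_le_add_one [Finite X] (p q : Perm X) (a b : X) :
    orbitCount (p * swap a b) q ≤ orbitCount p q + 1 := by
  set r := p * swap a b with hr
  have hp : ∀ x, p x = r (swap a b x) := fun x => by simp [hr]
  obtain ⟨g, hg, hab, hle⟩ := exists_merge (orbitClass r q) a b
  rw [orbitCount, ← ncard_range_of_surjective (orbitClass_surjective r q)]
  refine hle.trans (Nat.add_le_add_right (ncard_range_le_orbitCount g (fun x => ?_) fun x => ?_) 1)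
  · rw [hp, hg _ _ (orbitClass_left r q _), apply_swap_of_eq hab]
  · exact hg _ _ (orbitClass_right r q x)

theorem orbitCount_mul_swap_le [Finite X] (p q : Perm X) {a b : X}
    (h : orbitClass (p * swap a b) q a = orbitClass (p * swap a b) q b) :
    orbitCount (p * swap a b) q ≤ orbitCount p q := by
  set r := p * swap a b with hr
  have hp : ∀ x, p x = r (swap a b x) := fun x => by simp [hr]
  rw [orbitCount, ← ncard_range_of_surjective (orbitClass_surjective r q)]
  refine ncard_range_le_orbitCount _ (fun x => ?_) (orbitClass_right r q)
  rw [hp, orbitClass_left, apply_swap_of_eq h]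

/-- Started at `b`, the product runs through `p a`, `p (p a)`, … and agrees with `p` until it meets
`a` or `b`; the `p`-cycle of `a` avoids `b` and returns to `a`. -/
theorem sameCycle_mul_swap_of_not_sameCycle [Finite X] {p : Perm X} {a b : X}
    (h : ¬ p.SameCycle a b) : (p * swap a b).SameCycle a b := by
  by_contra hc
  have key : ∀ n : ℕ, (p * swap a b).SameCycle b ((p ^ (n + 1)) a) := by
    intro n
    induction n with
    | zero =>
      have : (p ^ (0 + 1)) a = (p * swap a b) b := by simp
      rw [this]
      exact (SameCycle.refl _ b).apply_right
    | succ n ih =>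
      have ha : (p ^ (n + 1)) a ≠ a := fun e => hc (by rw [e] at ih; exact ih.symm)
      have hb : (p ^ (n + 1)) a ≠ b := fun e => h ⟨(n + 1 : ℕ), by rw [zpow_natCast, e]⟩
      have : (p ^ (n + 1 + 1)) a = (p * swap a b) ((p ^ (n + 1)) a) := by
        rw [Perm.mul_apply, swap_apply_of_ne_of_ne ha hb, pow_succ' p (n + 1), Perm.mul_apply]
      rw [this]
      exact ih.apply_right
  obtain ⟨n, hn⟩ : ∃ n, orderOf p = n + 1 :=
    Nat.exists_eq_succ_of_ne_zero (orderOf_pos p).ne'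
  have := key n
  rw [← hn, pow_orderOf_eq_one] at this
  exact hc this.symm

/-- The stretch of the `p`-cycle from `p b` to the first occurrence of `a` is closed under the
product, because `a` is sent to `p b`; it does not contain `b`. -/
theorem not_sameCycle_mul_swap [Finite X] {p : Perm X} {a b : X} (hab : a ≠ b)
    (h : p.SameCycle a b) : ¬ (p * swap a b).SameCycle a b := by
  classical
  have hex : ∃ k : ℕ, (p ^ (k + 1)) b = a := by
    obtain ⟨i, hi0, hi⟩ := h.symm.exists_pow_eq'' 
    exact ⟨i - 1, by rw [Nat.sub_add_cancel hi0]; exact hi.2⟩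
  set k := Nat.find hex with hk
  have hka : (p ^ (k + 1)) b = a := Nat.find_spec hex
  have hmin : ∀ j, j < k → (p ^ (j + 1)) b ≠ a := fun j hj => Nat.find_min hex hj
  have hb : ∀ j, j < k → (p ^ (j + 1)) b ≠ b := by
    intro j hj e
    -- An early return to `b` could be cut out, and `a` would be reached sooner.
    refine hmin (k - (j + 1)) (by omega) ?_
    rw [← hka]
    conv_rhs => rw [show k + 1 = (k - (j + 1) + 1) + (j + 1) by omega, pow_add, Perm.mul_apply, e]
  let S : Set X := {x | ∃ j ≤ k, (p ^ (j + 1)) b = x}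
  have hS : ∀ x ∈ S, (p * swap a b) x ∈ S := by
    rintro x ⟨j, hj, rfl⟩
    rcases hj.lt_or_eq with hj | rfl
    · rw [Perm.mul_apply, swap_apply_of_ne_of_ne (hmin j hj) (hb j hj)]
      exact ⟨j + 1, hj, by rw [pow_succ' p (j + 1), Perm.mul_apply]⟩
    · rw [hka]
      exact ⟨0, Nat.zero_le _, by simp⟩
  have hbS : b ∉ S := by
    rintro ⟨j, hj, e⟩
    rcases hj.lt_or_eq with hj | rfl
    · exact hb j hj e
    · exact hab (hka ▸ e)
  intro hs
  obtain ⟨i, -, -, hi⟩ := hs.exists_pow_eq''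
  have : ∀ n : ℕ, ((p * swap a b) ^ n) a ∈ S := by
    intro n
    induction n with
    | zero => exact ⟨k, le_rfl, hka⟩
    | succ n ih => rw [pow_succ', Perm.mul_apply]; exact hS _ ih
  exact hbS (hi ▸ this i)

theorem cycleCount_lt_mul_swap [Finite X] {p : Perm X} {a b : X} (hab : a ≠ b)
    (h : p.SameCycle a b) : cycleCount p + 1 ≤ cycleCount (p * swap a b) := by
  set r := p * swap a b with hr
  have hinv : ∀ x, cycleClass p (r x) = cycleClass p x := fun x => by
    rw [hr, Perm.mul_apply, cycleClass_apply, apply_swap_of_eq (cycleClass_eq.2 h)]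
  let g : Quotient (SameCycle.setoid r) → Quotient (SameCycle.setoid p) :=
    Quotient.lift (cycleClass p) fun _ _ h => SameCycle.eq_of_invariant hinv h
  have hg : Function.Surjective g := by
    intro y
    obtain ⟨x, rfl⟩ := cycleClass_surjective p y
    exact ⟨cycleClass r x, rfl⟩
  have hle : cycleCount p ≤ cycleCount r := Nat.card_le_card_of_surjective g hg
  refine Nat.succ_le_of_lt (lt_of_le_of_ne hle fun heq => ?_)
  have hbij := (Nat.bijective_iff_surjective_and_card g).2 ⟨hg, heq.symm⟩
  have : cycleClass r a = cycleClass r b := hbij.1 (cycleClass_eq.2 h)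
  exact not_sameCycle_mul_swap hab h (cycleClass_eq.1 this)

/-- Splitting a cycle of `q⁻¹ * p` does not increase the genus of the hypermap `(p, q)`. -/
theorem genus_mul_swap_le [Finite X] {p q : Perm X} {a b : X} (hab : a ≠ b)
    (h : (q⁻¹ * p).SameCycle a b) :
    2 * orbitCount (p * swap a b) q + cycleCount p + cycleCount (q⁻¹ * p) ≤
      2 * orbitCount p q + cycleCount (p * swap a b) + cycleCount (q⁻¹ * (p * swap a b)) := by
  have h1 := cycleCount_lt_mul_swap hab h
  rw [mul_assoc] at h1
  have h2 := cycleCount_mul_swap_le_add_one (p * swap a b) a b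
  rw [mul_assoc, swap_mul_self, mul_one] at h2
  -- If `a` and `b` stay connected, no orbit is gained, and the new cycle of `q⁻¹ * p` pays for the
  -- possible loss of a cycle of `p`. Otherwise at most one orbit is gained, and the cycle of `p`
  -- splits as well.
  by_cases hc : orbitClass (p * swap a b) q a = orbitClass (p * swap a b) q b
  · have := orbitCount_mul_swap_le p q hc
    omega
  · have h3 : ¬ (p * swap a b).SameCycle a b := fun hs =>
      hc (SameCycle.eq_of_invariant (orbitClass_left _ q) hs)
    have h4 := sameCycle_mul_swap_of_not_sameCycle h3
    rw [mul_assoc, swap_mul_self, mul_one] at h4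
    have h5 := cycleCount_lt_mul_swap hab h4
    have h6 := orbitCount_mul_swap_le_add_one p q a b
    omega

theorem IsSpherical.mul_swap [Finite X] {p q : Perm X} {a b : X} (hpq : IsSpherical p q)
    (hab : a ≠ b) (h : (q⁻¹ * p).SameCycle a b) : IsSpherical (p * swap a b) q := by
  have := genus_mul_swap_le hab h
  unfold IsSpherical at *
  omega

end Swap

/-! ### Nonnegativity of the genus and restriction to invariant sets -/

section Genus

variable {X : Type*} [Finite X]

/-- The genus of a hypermap is nonnegative. -/
theorem cycleCount_add_le (p q : Perm X) :
    cycleCount p + cycleCount q + cycleCount (q⁻¹ * p) ≤ Nat.card X + 2 * orbitCount p q := by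
  classical
  have := Fintype.ofFinite X
  -- Splitting fixed points off `q⁻¹ * p` one by one never increases the genus and ends at `p = q`,
  -- where the inequality is immediate.
  induction hn : (q⁻¹ * p).support.card using Nat.strong_induction_on generalizing p with
  | _ n ih =>
    by_cases h1 : q⁻¹ * p = 1
    · obtain rfl : p = q := by rwa [inv_mul_eq_one, eq_comm] at h1
      have := cycleCount_le_card (p⁻¹ * p)
      have h2 : cycleCount p ≤ orbitCount p p := by
        conv_lhs => rw [cycleCount, ← ncard_range_of_surjective (cycleClass_surjective p)]
        exact ncard_range_le_orbitCount _ (cycleClass_apply p) (cycleClass_apply p)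
      omega
    · obtain ⟨x, hx⟩ : ∃ x, (q⁻¹ * p) x ≠ x := by
        by_contra! hc
        exact h1 (Perm.ext hc)
      have hlt := card_support_swap_mul hx
      rw [swap_mul_eq_mul_swap, show (q⁻¹ * p)⁻¹ ((q⁻¹ * p) x) = x from symm_apply_apply _ x] at hlt
      set r := q⁻¹ * p with hr
      have hne : r⁻¹ x ≠ x := fun e => hx ((congrArg r e).symm.trans (apply_symm_apply r x))
      have hsc : r.SameCycle (r⁻¹ x) x := ⟨1, by simp⟩
      have h3 := genus_mul_swap_le hne hsc
      have h4 := ih _ (hn ▸ hlt) (p * swap (r⁻¹ x) x) (by rw [← mul_assoc])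
      rw [← hr] at *
      omega

theorem IsSpherical.eq {p q : Perm X} (h : IsSpherical p q) :
    Nat.card X + 2 * orbitCount p q = cycleCount p + cycleCount q + cycleCount (q⁻¹ * p) :=
  le_antisymm h (cycleCount_add_le p q)

/-- Here `q⁻¹ * p = 1` has one cycle per point, and there are at least as many cycles as orbits. -/
theorem isSpherical_self (p : Perm X) : IsSpherical p p := by
  have h1 := orbitCount_le_cycleCount_right p p
  have h2 : Nat.card X ≤ cycleCount (p⁻¹ * p) := by
    rw [← ncard_range_of_surjective (Function.surjective_id (α := X))]
    exact ncard_range_le_cycleCount _ fun x => by simp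
  unfold IsSpherical
  omega

theorem cycleCount_le_subtypePerm_add (p : Perm X) (S : X → Prop) (hS : ∀ x, S (p x) ↔ S x) :
    cycleCount p ≤ cycleCount (p.subtypePerm hS) +
      cycleCount (p.subtypePerm (p := fun x => ¬ S x) fun x => not_congr (hS x)) := by
  unfold cycleCount
  rw [← Nat.card_sum]
  refine Nat.card_le_card_of_surjective (Sum.elim
    (Quotient.lift (fun x => cycleClass p x.1) fun _ _ h =>
      cycleClass_eq.2 (sameCycle_subtypePerm.1 h))
    (Quotient.lift (fun x => cycleClass p x.1) fun _ _ h =>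
      cycleClass_eq.2 (sameCycle_subtypePerm.1 h))) fun y => ?_
  obtain ⟨x, rfl⟩ := cycleClass_surjective p y
  by_cases hx : S x
  · exact ⟨Sum.inl (cycleClass _ ⟨x, hx⟩), rfl⟩
  · exact ⟨Sum.inr (cycleClass _ ⟨x, hx⟩), rfl⟩

theorem orbitCount_subtypePerm_add_le (p q : Perm X) (S : X → Prop) (hp : ∀ x, S (p x) ↔ S x)
    (hq : ∀ x, S (q x) ↔ S x) :
    orbitCount (p.subtypePerm hp) (q.subtypePerm hq) +
      orbitCount (p.subtypePerm (p := fun x => ¬ S x) fun x => not_congr (hp x))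
        (q.subtypePerm (p := fun x => ¬ S x) fun x => not_congr (hq x)) ≤ orbitCount p q := by
  classical
  rw [orbitCount, orbitCount, ← Nat.card_sum]
  let f : X → (Quot fun x y => y = p.subtypePerm hp x ∨ y = q.subtypePerm hq x) ⊕
      (Quot fun x y => y = p.subtypePerm (p := fun x => ¬ S x) (fun x => not_congr (hp x)) x ∨
        y = q.subtypePerm (p := fun x => ¬ S x) (fun x => not_congr (hq x)) x) := fun x => if h : S x then
      Sum.inl (orbitClass (p.subtypePerm hp) (q.subtypePerm hq) ⟨x, h⟩)
    else Sum.inr (orbitClass (p.subtypePerm (p := fun x => ¬ S x) fun x => not_congr (hp x))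
        (q.subtypePerm (p := fun x => ¬ S x) fun x => not_congr (hq x)) ⟨x, h⟩)
  have hf : Function.Surjective f := by
    rintro (y | y)
    · obtain ⟨⟨x, hx⟩, rfl⟩ := orbitClass_surjective _ _ y
      exact ⟨x, by simp [f, hx]⟩
    · obtain ⟨⟨x, hx⟩, rfl⟩ := orbitClass_surjective _ _ y
      exact ⟨x, by simp [f, hx]⟩
  rw [← ncard_range_of_surjective hf]
  refine ncard_range_le_orbitCount f (fun x => ?_) fun x => ?_
  · by_cases h : S x
    · simp only [f, hp, h, dite_true]
      exact congrArg Sum.inl (orbitClass_left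
        (p.subtypePerm hp)
        (q.subtypePerm hq) ⟨x, h⟩)
    · simp only [f, hp, h, dite_false]
      exact congrArg Sum.inr (orbitClass_left
        (p.subtypePerm (p := fun x => ¬ S x) fun x => not_congr (hp x))
        (q.subtypePerm (p := fun x => ¬ S x) fun x => not_congr (hq x)) ⟨x, h⟩)
  · by_cases h : S x
    · simp only [f, hq, h, dite_true]
      exact congrArg Sum.inl (orbitClass_right
        (p.subtypePerm hp)
        (q.subtypePerm hq) ⟨x, h⟩)
    · simp only [f, hq, h, dite_false]
      exact congrArg Sum.inr (orbitClass_right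
        (p.subtypePerm (p := fun x => ¬ S x) fun x => not_congr (hp x))
        (q.subtypePerm (p := fun x => ¬ S x) fun x => not_congr (hq x)) ⟨x, h⟩)

/-- Points, cycles and orbits all distribute over the set and its complement, so the two genera add
up to at most zero; the one of the complement is nonnegative by `cycleCount_add_le`. -/
theorem IsSpherical.subtypePerm {p q : Perm X} (h : IsSpherical p q) (S : X → Prop)
    (hp : ∀ x, S (p x) ↔ S x) (hq : ∀ x, S (q x) ↔ S x) :
    IsSpherical (p.subtypePerm hp) (q.subtypePerm hq) := by
  classical
  have hr : ∀ x, S ((q⁻¹ * p) x) ↔ S x := fun x => by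
    rw [← hq, Perm.mul_apply, show q (q⁻¹ (p x)) = p x from apply_symm_apply _ _, hp]
  have h1 := cycleCount_le_subtypePerm_add p S hp
  have h2 := cycleCount_le_subtypePerm_add q S hq
  have h3 := cycleCount_le_subtypePerm_add (q⁻¹ * p) S hr
  have h4 := orbitCount_subtypePerm_add_le p q S hp hq
  have h5 := cycleCount_add_le (p.subtypePerm (p := fun x => ¬ S x) fun x => not_congr (hp x))
    (q.subtypePerm (p := fun x => ¬ S x) fun x => not_congr (hq x))
  have e1 : (q.subtypePerm hq)⁻¹ * p.subtypePerm hp = (q⁻¹ * p).subtypePerm hr := by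
    ext x
    rfl
  have e2 : (q.subtypePerm (p := fun x => ¬ S x) fun x => not_congr (hq x))⁻¹ *
      p.subtypePerm (p := fun x => ¬ S x) (fun x => not_congr (hp x)) =
      (q⁻¹ * p).subtypePerm (p := fun x => ¬ S x) fun x => not_congr (hr x) := by
    ext x
    rfl
  have h6 : Nat.card {x // S x} + Nat.card {x // ¬ S x} = Nat.card X := by
    rw [← Nat.card_sum, Nat.card_congr (Equiv.sumCompl S)]
  unfold IsSpherical at *
  rw [e1]
  rw [e2] at h5
  omega

end Genus

/-! ### Alternating embeddings as hypermaps on the arcs -/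

namespace MultiDigraph

/-- Two permutations of the arcs that lead from every arc to an arc that continues it, such that
the cycles of `q⁻¹ * p` are the sets of arcs with a common target. They encode an alternating
rotation system: the facial walks are the cycles of `p` and those of `q`. -/
structure IsTransitionPair (G : MultiDigraph) (p q : Perm G.E) : Prop where
  src_apply : ∀ e, G.src (p e) = G.tgt e
  sameCycle_iff : ∀ e e', (q⁻¹ * p).SameCycle e e' ↔ G.tgt e = G.tgt e'

namespace IsTransitionPair

variable {G : MultiDigraph} {p q : Perm G.E}

theorem src_apply_right (h : G.IsTransitionPair p q) (e : G.E) : G.src (q e) = G.tgt e := by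
  have h1 : G.tgt (p⁻¹ (q e)) = G.tgt e := by
    refine (h.sameCycle_iff _ _).1 ⟨1, ?_⟩
    simp
  rw [← h1, ← h.src_apply]
  simp

theorem tgt_inv (h : G.IsTransitionPair p q) (e : G.E) : G.tgt (p⁻¹ e) = G.src e := by
  rw [← h.src_apply]
  simp

theorem tgt_inv_right (h : G.IsTransitionPair p q) (e : G.E) : G.tgt (q⁻¹ e) = G.src e := by
  rw [← h.src_apply_right]
  simp

/-- An out-arc `e` at `v` would yield the in-arc `p⁻¹ e`, so the absence of in-arcs is enough. -/
theorem isIsolated_iff (h : G.IsTransitionPair p q) (v : G.V) :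
    G.IsIsolated v ↔ v ∉ Set.range G.tgt := by
  constructor
  · rintro hv ⟨e, rfl⟩
    exact (hv e).2 rfl
  · intro hv e
    exact ⟨fun he => hv ⟨p⁻¹ e, by rw [h.tgt_inv, he]⟩, fun he => hv ⟨e, he⟩⟩

theorem card_vertices (h : G.IsTransitionPair p q) :
    Nat.card G.V = cycleCount (q⁻¹ * p) + {v : G.V | G.IsIsolated v}.ncard := by
  have h1 : {v : G.V | G.IsIsolated v} = (Set.range G.tgt)ᶜ := by
    ext v
    exact h.isIsolated_iff v
  have h2 : cycleCount (q⁻¹ * p) = (Set.range G.tgt).ncard := by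
    apply le_antisymm
    · let g : Quotient (SameCycle.setoid (q⁻¹ * p)) → Set.range G.tgt :=
        Quotient.lift (fun e => ⟨G.tgt e, e, rfl⟩) fun e e' he =>
          Subtype.ext ((h.sameCycle_iff e e').1 he)
      refine Nat.card_le_card_of_injective g ?_
      rintro ⟨e⟩ ⟨e'⟩ he
      exact cycleClass_eq.2 ((h.sameCycle_iff e e').2 (congrArg Subtype.val he))
    · refine ncard_range_le_cycleCount _ fun e => ?_
      exact (h.sameCycle_iff _ _).1 (SameCycle.refl _ e).apply_left
  rw [h1, h2, Set.ncard_add_ncard_compl]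

theorem orbitClass_eq_of_tgt_eq (h : G.IsTransitionPair p q) {e e' : G.E}
    (he : G.tgt e = G.tgt e') : orbitClass p q e = orbitClass p q e' := by
  refine SameCycle.eq_of_invariant (fun x => ?_) ((h.sameCycle_iff e e').2 he)
  rw [← orbitClass_right p q, Perm.mul_apply, show q (q⁻¹ (p x)) = p x from apply_symm_apply _ _,
    orbitClass_left]

/-- Arcs with a common head lie in one orbit, so a nonisolated vertex determines an orbit, constant
along arcs; each isolated vertex is a component without arcs. -/
theorem numComponents_eq (h : G.IsTransitionPair p q) :
    G.numComponents = orbitCount p q + {v : G.V | G.IsIsolated v}.ncard := by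
  classical
  rw [numComponents, orbitCount, ← Nat.card_coe_set_eq, ← Nat.card_sum]
  apply le_antisymm
  · let g : (Quot fun x y => y = p x ∨ y = q x) ⊕ {v : G.V | G.IsIsolated v} →
        Quot fun u v : G.V => ∃ e : G.E, G.src e = u ∧ G.tgt e = v :=
      Sum.elim (Quot.lift (fun e => Quot.mk _ (G.tgt e)) (by
        rintro x y (rfl | rfl)
        · exact Quot.sound ⟨p x, h.src_apply x, rfl⟩
        · exact Quot.sound ⟨q x, h.src_apply_right x, rfl⟩)) fun v => Quot.mk _ v.1
    refine Nat.card_le_card_of_surjective g ?_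
    rintro ⟨v⟩
    by_cases hv : G.IsIsolated v
    · exact ⟨Sum.inr ⟨v, hv⟩, rfl⟩
    · rw [h.isIsolated_iff, not_not] at hv
      obtain ⟨e, rfl⟩ := hv
      exact ⟨Sum.inl (orbitClass p q e), rfl⟩
  · let f : G.V → (Quot fun x y => y = p x ∨ y = q x) ⊕ {v : G.V | G.IsIsolated v} :=
      fun v => if hv : G.IsIsolated v then Sum.inr ⟨v, hv⟩ else
        Sum.inl (orbitClass p q (not_not.1 fun hc => hv ((h.isIsolated_iff v).2 hc)).choose)
    have hft : ∀ e, f (G.tgt e) = Sum.inl (orbitClass p q e) := by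
      intro e
      have hv : ¬ G.IsIsolated (G.tgt e) := fun hv => (hv e).2 rfl
      simp only [f, hv, dite_false]
      exact congrArg Sum.inl (h.orbitClass_eq_of_tgt_eq
        (not_not.1 fun hc => hv ((h.isIsolated_iff _).2 hc)).choose_spec)
    have hf : Function.Surjective f := by
      rintro (y | ⟨v, hv⟩)
      · obtain ⟨e, rfl⟩ := orbitClass_surjective _ _ y
        exact ⟨G.tgt e, hft e⟩
      · have hv' : G.IsIsolated v := hv
        exact ⟨v, by simp [f, hv']⟩
    rw [← ncard_range_of_surjective hf]
    refine ncard_range_le_card_quot f ?_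
    rintro _ _ ⟨e, rfl, rfl⟩
    rw [← h.tgt_inv, hft, hft, ← orbitClass_left p q (p⁻¹ e),
      show p (p⁻¹ e) = e from apply_symm_apply _ _]

end IsTransitionPair

/-- The rotation `(e, false) ↦ (p e, true) ↦ (q⁻¹ (p e), false)` on the half-arcs. -/
def pairRot {E : Type*} (p q : Perm E) : Perm (E × Bool) where
  toFun d := if d.2 then (q⁻¹ d.1, false) else (p d.1, true)
  invFun d := if d.2 then (p⁻¹ d.1, false) else (q d.1, true)
  left_inv := by rintro ⟨e, _ | _⟩ <;> simp
  right_inv := by rintro ⟨e, _ | _⟩ <;> simp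

theorem pairRot_false {E : Type*} (p q : Perm E) (e : E) :
    pairRot p q (e, false) = (p e, true) := rfl

theorem pairRot_true {E : Type*} (p q : Perm E) (e : E) :
    pairRot p q (e, true) = (q⁻¹ e, false) := rfl

/-- Two steps of the rotation lead from an in-half to the next in-half and act there as `q⁻¹ * p`.
-/
theorem pairRot_sameCycle_iff {E : Type*} (p q : Perm E) (e e' : E) :
    (pairRot p q).SameCycle (e, false) (e', false) ↔ (q⁻¹ * p).SameCycle e e' := by
  constructor
  · intro h
    have := SameCycle.eq_of_invariant
      (f := fun d : E × Bool => cycleClass (q⁻¹ * p) (if d.2 then p⁻¹ d.1 else d.1)) ?_ h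
    · exact cycleClass_eq.1 this
    · rintro ⟨e, _ | _⟩
      · simp [pairRot_false]
      · have := cycleClass_apply (q⁻¹ * p) (p⁻¹ e)
        simpa [pairRot_true] using this
  · intro h
    have := SameCycle.eq_of_invariant (f := fun e => cycleClass (pairRot p q) (e, false)) ?_ h
    · exact cycleClass_eq.1 this
    · intro x
      have h1 := cycleClass_apply (pairRot p q) (x, false)
      have h2 := cycleClass_apply (pairRot p q) (p x, true)
      rw [pairRot_false] at h1
      rw [pairRot_true] at h2
      exact h2.trans h1

/-- For the face tracing permutation: walks that follow the arcs forwards are governed by `p`, walks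
that follow them backwards by `q⁻¹`, and the two kinds never mix. -/
theorem cycleCount_prod_bool {E : Type*} [Finite E] (p q : Perm E) (φ : Perm (E × Bool))
    (ht : ∀ e, φ (e, true) = (p e, true)) (hf : ∀ e, φ (e, false) = (q⁻¹ e, false)) :
    cycleCount φ = cycleCount p + cycleCount q := by
  have hq : ∀ e, cycleClass q (q⁻¹ e) = cycleClass q e := fun e => by
    rw [← cycleClass_apply q (q⁻¹ e), show q (q⁻¹ e) = e from apply_symm_apply _ _]
  apply le_antisymm
  · unfold cycleCount
    rw [← Nat.card_sum]
    refine Nat.card_le_card_of_surjective (Sum.elim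
      (Quotient.lift (fun x => cycleClass φ (x, true)) fun _ _ h =>
        SameCycle.eq_of_invariant (p := p)
          (f := fun x => cycleClass φ (x, true)) (fun x => ?_) h)
      (Quotient.lift (fun x => cycleClass φ (x, false)) fun _ _ h =>
        SameCycle.eq_of_invariant (p := q⁻¹)
          (f := fun x => cycleClass φ (x, false)) (fun x => ?_) (sameCycle_inv.2 h))) fun y => ?_
    · rw [← ht, cycleClass_apply]
    · rw [← hf, cycleClass_apply]
    · obtain ⟨⟨x, _ | _⟩, rfl⟩ := cycleClass_surjective φ y
      · exact ⟨Sum.inr (cycleClass _ x), rfl⟩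
      · exact ⟨Sum.inl (cycleClass _ x), rfl⟩
  · let f : E × Bool → Quotient (SameCycle.setoid p) ⊕ Quotient (SameCycle.setoid q) :=
      fun d => if d.2 then Sum.inl (cycleClass p d.1) else Sum.inr (cycleClass q d.1)
    have hs : Function.Surjective f := by
      rintro (y | y)
      · obtain ⟨x, rfl⟩ := cycleClass_surjective _ y
        exact ⟨(x, true), rfl⟩
      · obtain ⟨x, rfl⟩ := cycleClass_surjective _ y
        exact ⟨(x, false), rfl⟩
    rw [cycleCount, cycleCount, ← Nat.card_sum, ← ncard_range_of_surjective hs]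
    refine ncard_range_le_cycleCount f ?_
    rintro ⟨e, _ | _⟩
    · rw [hf]
      exact congrArg Sum.inr (hq e)
    · rw [ht]
      exact congrArg Sum.inl (cycleClass_apply p e)

namespace RotationSystem

variable {G : MultiDigraph} {p q : Perm G.E}

theorem numFaces_eq (R : G.RotationSystem) (hR : R.rot = pairRot p q) :
    R.numFaces = cycleCount p + cycleCount q + {v : G.V | G.IsIsolated v}.ncard := by
  rw [numFaces, ← cycleCount_prod_bool p q R.facePerm]
  · rfl
  · intro e
    simp [facePerm, hR, dartRev, pairRot_false]
  · intro e
    simp [facePerm, hR, dartRev, pairRot_true]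

/-- Each isolated vertex counts once as a vertex, once as a face and twice on the other side of
Euler's formula, so it cancels. The inequality `cycleCount_add_le` turns the defining inequality of
a spherical pair into an equation. -/
theorem isPlanar_iff_isSpherical (R : G.RotationSystem) (hR : R.rot = pairRot p q)
    (h : G.IsTransitionPair p q) : R.IsPlanar ↔ IsSpherical p q := by
  have h1 := R.numFaces_eq hR
  have h2 := h.card_vertices
  have h3 := h.numComponents_eq
  have h4 := cycleCount_add_le p q
  unfold IsPlanar IsSpherical
  omega

/-- Alternation sends in-halves to out-halves, both under the rotation and under its inverse; read
on in-halves, these two maps are `p` and `q`. -/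
theorem IsAlternating.exists_pairRot {R : G.RotationSystem} (h : R.IsAlternating) :
    ∃ p q : Perm G.E, R.rot = pairRot p q := by
  have h' : ∀ d : G.Dart, (R.rot.symm d).2 = !d.2 := fun d => by
    have := h (R.rot.symm d)
    rw [apply_symm_apply] at this
    simp [this]
  have e1 : ∀ e, R.rot (e, false) = ((R.rot (e, false)).1, true) := fun e =>
    Prod.ext rfl (h (e, false))
  have e2 : ∀ e, R.rot (e, true) = ((R.rot (e, true)).1, false) := fun e =>
    Prod.ext rfl (h (e, true))
  have e3 : ∀ e, R.rot.symm (e, false) = ((R.rot.symm (e, false)).1, true) := fun e =>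
    Prod.ext rfl (h' (e, false))
  have e4 : ∀ e, R.rot.symm (e, true) = ((R.rot.symm (e, true)).1, false) := fun e =>
    Prod.ext rfl (h' (e, true))
  refine ⟨⟨fun e => (R.rot (e, false)).1, fun e => (R.rot.symm (e, true)).1, fun e => ?_,
    fun e => ?_⟩, ⟨fun e => (R.rot.symm (e, false)).1, fun e => (R.rot (e, true)).1, fun e => ?_,
    fun e => ?_⟩, ?_⟩
  · simp only [← e1, symm_apply_apply]
  · simp only [← e4, apply_symm_apply]
  · simp only [← e3, apply_symm_apply]
  · simp only [← e2, symm_apply_apply]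
  · ext1 ⟨e, _ | _⟩
    · exact e1 e
    · exact e2 e

end RotationSystem

/-- An alternating embedding in the plane amounts to a spherical transition pair. -/
theorem isDiplanar_iff (G : MultiDigraph) :
    G.IsDiplanar ↔ ∃ p q : Perm G.E, G.IsTransitionPair p q ∧ IsSpherical p q := by
  constructor
  · rintro ⟨R, hR, hpl⟩
    obtain ⟨p, q, hrot⟩ := hR.exists_pairRot
    have h : G.IsTransitionPair p q := by
      refine ⟨fun e => ?_, fun e e' => ?_⟩
      · have := (R.sameCycle_iff (e, false) (p e, true)).1 ⟨1, by simp [hrot, pairRot_false]⟩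
        simpa [dartVertex] using this.symm
      · rw [← pairRot_sameCycle_iff, ← hrot, R.sameCycle_iff]
        simp [dartVertex]
    exact ⟨p, q, h, (R.isPlanar_iff_isSpherical hrot h).1 hpl⟩
  · rintro ⟨p, q, h, hs⟩
    have hred : ∀ d : G.Dart, ∃ e, (pairRot p q).SameCycle d (e, false) ∧
        G.dartVertex d = G.tgt e := by
      rintro ⟨e, _ | _⟩
      · exact ⟨e, SameCycle.refl _ _, by simp [dartVertex]⟩
      · refine ⟨q⁻¹ e, ⟨1, by simp [pairRot_true]⟩, ?_⟩
        rw [h.tgt_inv_right]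
        simp [dartVertex]
    let R : G.RotationSystem := ⟨pairRot p q, fun d d' => by
      obtain ⟨e, he, hv⟩ := hred d
      obtain ⟨e', he', hv'⟩ := hred d'
      rw [hv, hv', ← h.sameCycle_iff, ← pairRot_sameCycle_iff]
      exact ⟨fun hd => he.symm.trans (hd.trans he'), fun hd => he.trans (hd.trans he'.symm)⟩⟩
    refine ⟨R, ?_, (R.isPlanar_iff_isSpherical rfl h).2 hs⟩
    rintro ⟨e, _ | _⟩ <;> rfl

end MultiDigraph

/-! ### Reduction steps preserve diplanarity -/

theorem IsSpherical.permCongr {X Y : Type*} [Finite X] {p q : Perm X} (h : IsSpherical p q)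
    (e : X ≃ Y) : IsSpherical (e.permCongr p) (e.permCongr q) := by
  have := Finite.of_equiv X e
  have hc : ∀ p : Perm X, cycleCount p ≤ cycleCount (e.permCongr p) := by
    intro p
    conv_lhs => rw [cycleCount, ← ncard_range_of_surjective
      ((cycleClass_surjective p).comp e.symm.surjective)]
    refine ncard_range_le_cycleCount _ fun y => ?_
    simp [cycleClass_apply]
  have ho : orbitCount (e.permCongr p) (e.permCongr q) ≤ orbitCount p q := by
    conv_lhs => rw [orbitCount, ← ncard_range_of_surjective
      ((orbitClass_surjective (e.permCongr p) (e.permCongr q)).comp e.surjective)]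
    refine ncard_range_le_orbitCount _ (fun x => ?_) fun x => ?_
    · have := orbitClass_left (e.permCongr p) (e.permCongr q) (e x)
      rwa [permCongr_apply, symm_apply_apply] at this
    · have := orbitClass_right (e.permCongr p) (e.permCongr q) (e x)
      rwa [permCongr_apply, symm_apply_apply] at this
  have h1 := hc p
  have h2 := hc q
  have h3 := hc (q⁻¹ * p)
  have h4 : (e.permCongr q)⁻¹ * e.permCongr p = e.permCongr (q⁻¹ * p) := by
    rw [inv_mul_eq_iff_eq_mul]
    ext x
    simp
  unfold IsSpherical at *
  rw [h4, ← Nat.card_congr e]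
  omega

namespace MultiDigraph

/-- A spherical pair of permutations restricts to an invariant set of arcs. -/
theorem isDiplanar_of_range_invariant (H : MultiDigraph) {E : Type*} [Finite E] (p q : Perm E)
    (hs : IsSpherical p q) (f : H.E → E) (hf : Function.Injective f)
    (hp : ∀ x, p x ∈ Set.range f ↔ x ∈ Set.range f)
    (hq : ∀ x, q x ∈ Set.range f ↔ x ∈ Set.range f)
    (hsrc : ∀ a b, p (f a) = f b → H.src b = H.tgt a)
    (htgt : ∀ a b, (q⁻¹ * p).SameCycle (f a) (f b) ↔ H.tgt a = H.tgt b) : H.IsDiplanar := by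
  let g : H.E ≃ Set.range f := Equiv.ofInjective f hf
  have hg : ∀ a, (g a : E) = f a := fun a => rfl
  have hg' : ∀ y : Set.range f, f (g.symm y) = y := fun y => by rw [← hg, apply_symm_apply]
  let p' : Perm (Set.range f) := p.subtypePerm hp
  let q' : Perm (Set.range f) := q.subtypePerm hq
  have hs' := (hs.subtypePerm (fun x => x ∈ Set.range f) hp hq).permCongr g.symm
  refine (isDiplanar_iff H).2 ⟨g.symm.permCongr p', g.symm.permCongr q', ⟨fun e => ?_, ?_⟩, hs'⟩
  · refine hsrc _ _ ?_
    rw [permCongr_apply, hg']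
    rfl
  · intro a b
    rw [← htgt]
    have h1 : ∀ x, f (((g.symm.permCongr q')⁻¹ * g.symm.permCongr p') x) = (q⁻¹ * p) (f x) := by
      intro x
      apply q.injective
      have h2 : q (f (((g.symm.permCongr q')⁻¹ * g.symm.permCongr p') x)) =
          f (g.symm.permCongr q' (((g.symm.permCongr q')⁻¹ * g.symm.permCongr p') x)) := by
        rw [permCongr_apply, hg']
        rfl
      rw [h2, Perm.mul_apply, show ∀ y, g.symm.permCongr q' ((g.symm.permCongr q')⁻¹ y) = y from
        apply_symm_apply _, permCongr_apply, hg', Perm.mul_apply,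
        show q (q⁻¹ (p (f x))) = p (f x) from apply_symm_apply _ _]
      rfl
    constructor
    · intro h
      refine cycleClass_eq.1 (SameCycle.eq_of_invariant
        (f := fun x => cycleClass (q⁻¹ * p) (f x)) (fun x => ?_) h)
      rw [h1, cycleClass_apply]
    · intro h
      obtain ⟨i, -, -, hi⟩ := h.exists_pow_eq''
      refine ⟨(i : ℤ), ?_⟩
      rw [zpow_natCast]
      apply hf
      rw [← hi]
      have : ∀ n : ℕ, f ((((g.symm.permCongr q')⁻¹ * g.symm.permCongr p') ^ n) a) =
          ((q⁻¹ * p) ^ n) (f a) := by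
        intro n
        induction n with
        | zero => rfl
        | succ n ih => rw [pow_succ', Perm.mul_apply, h1, ih, pow_succ' (q⁻¹ * p), Perm.mul_apply _ (_ ^ n)]
      exact this i

/-- At most two arcs end at each vertex. -/
def InDegreeLeTwo (G : MultiDigraph) : Prop :=
  ∀ x y z : G.E, G.tgt x = G.tgt y → G.tgt x = G.tgt z → x = y ∨ x = z ∨ y = z

section DirectedCycle

variable {G : MultiDigraph} {C : Set G.E}

theorem IsDirectedCycle.src_injOn (h : G.IsDirectedCycle C) : Set.InjOn G.src C := by
  obtain ⟨m, c, hc, -, rfl⟩ := h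
  rintro _ ⟨i, rfl⟩ _ ⟨j, rfl⟩ hij
  rw [hc hij]

theorem IsDirectedCycle.tgt_injOn (h : G.IsDirectedCycle C) : Set.InjOn G.tgt C := by
  obtain ⟨m, c, hc, ht, rfl⟩ := h
  rintro _ ⟨i, rfl⟩ _ ⟨j, rfl⟩ hij
  rw [ht, ht] at hij
  rw [add_right_cancel (hc hij)]

theorem IsDirectedCycle.exists_src_eq_tgt (h : G.IsDirectedCycle C) {x : G.E} (hx : x ∈ C) :
    ∃ y ∈ C, G.src y = G.tgt x := by
  obtain ⟨m, c, hc, ht, rfl⟩ := h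
  obtain ⟨i, rfl⟩ := hx
  exact ⟨_, ⟨i + 1, rfl⟩, (ht i).symm⟩

theorem IsDirectedCycle.exists_tgt_eq_src (h : G.IsDirectedCycle C) {x : G.E} (hx : x ∈ C) :
    ∃ y ∈ C, G.tgt y = G.src x := by
  obtain ⟨m, c, hc, ht, rfl⟩ := h
  obtain ⟨i, rfl⟩ := hx
  exact ⟨_, ⟨i - 1, rfl⟩, by rw [ht, sub_add_cancel]⟩

/-- A state of the process that makes the arc set `C` invariant under the transitions: at every
vertex the transitions are opposite, or `C` visits the vertex and the transitions coincide and
respect `C`. -/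
structure IsPartlySplit (G : MultiDigraph) (C : Set G.E) (p q : Perm G.E) : Prop where
  spherical : IsSpherical p q
  src_left : ∀ e, G.src (p e) = G.tgt e
  src_right : ∀ e, G.src (q e) = G.tgt e
  split : ∀ x y, G.tgt x = G.tgt y → x ≠ y →
    p x = q y ∨ (p x = q x ∧ (p x ∈ C ↔ x ∈ C) ∧ ∃ z ∈ C, G.tgt z = G.tgt x)

theorem IsPartlySplit.symm {p q : Perm G.E} (h : G.IsPartlySplit C p q) :
    G.IsPartlySplit C q p := by
  refine ⟨h.spherical.symm, h.src_right, h.src_left, fun x y hxy hne => ?_⟩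
  rcases h.split x y hxy hne with h1 | ⟨h1, h2, h3⟩
  · rcases h.split y x hxy.symm hne.symm with h4 | ⟨h4, -⟩
    · exact Or.inl h4.symm
    · exact absurd (p.injective (h1.trans h4.symm)) hne
  · exact Or.inr ⟨h1.symm, h1 ▸ h2, h3⟩

/-- Where `p` leaves `C`, the transitions are still opposite. Exchanging the two values of `p` there
makes `p` follow `C` and agree with `q`. The two in-arcs lie in one cycle of `q⁻¹ * p`, so this
splits a vertex and keeps genus zero, and fewer arcs of `C` are led astray. -/
theorem IsPartlySplit.exists_left_invariant (hC : G.IsDirectedCycle C)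
    {p q : Perm G.E} (h : G.IsPartlySplit C p q) :
    ∃ p', G.IsPartlySplit C p' q ∧ ∀ x ∈ C, p' x ∈ C := by
  classical
  induction hn : {x | x ∈ C ∧ p x ∉ C}.ncard using Nat.strong_induction_on generalizing p with
  | _ n ih =>
    by_cases hex : ∃ e ∈ C, p e ∉ C
    · obtain ⟨e, heC, hpe⟩ := hex
      obtain ⟨c, hcC, hc⟩ := hC.exists_src_eq_tgt heC
      obtain ⟨a, rfl⟩ := p.surjective c
      have hta : G.tgt e = G.tgt a := by rw [← hc, h.src_left]
      have hne : e ≠ a := by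
        rintro rfl
        exact hpe hcC
      have haC : a ∉ C := fun ha => hne (hC.tgt_injOn heC ha hta)
      have h1 : p e = q a := by
        rcases h.split e a hta hne with h1 | ⟨-, h1, -⟩
        · exact h1
        · exact absurd (h1.2 heC) hpe
      have h2 : p a = q e := by
        rcases h.split a e hta.symm hne.symm with h2 | ⟨-, h2, -⟩
        · exact h2
        · exact absurd (h2.1 hcC) haC
      have hsc : (q⁻¹ * p).SameCycle e a := ⟨1, by simp [h1]⟩
      have hpe' : (p * swap e a) e = p a := by simp
      have hpa' : (p * swap e a) a = p e := by simp
      have hpx' : ∀ x, x ≠ e → x ≠ a → (p * swap e a) x = p x := fun x hx hx' => by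
        rw [Perm.mul_apply, swap_apply_of_ne_of_ne hx hx']
      have hsplit : G.IsPartlySplit C (p * swap e a) q := by
        refine ⟨h.spherical.mul_swap hne hsc, fun x => ?_, h.src_right, fun x y hxy hxy' => ?_⟩
        · rw [Perm.mul_apply, h.src_left, apply_swap_of_eq hta]
        · by_cases hxe : x = e
          · subst hxe
            exact Or.inr ⟨by rw [hpe', h2], by simp [hpe', hcC, heC], x, heC, rfl⟩
          by_cases hxa : x = a
          · subst hxa
            exact Or.inr ⟨by rw [hpa', h1], by simp [hpa', hpe, haC], e, heC, hta⟩
          rw [hpx' x hxe hxa]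
          exact h.split x y hxy hxy'
      refine ih _ ?_ hsplit rfl
      rw [← hn]
      refine Set.ncard_lt_ncard ?_
      refine ⟨fun x hx => ?_, fun hsub => ?_⟩
      · have hxe : x ≠ e := by
          rintro rfl
          exact hx.2 (hpe' ▸ hcC)
        have hxa : x ≠ a := by
          rintro rfl
          exact haC hx.1
        exact ⟨hx.1, hpx' x hxe hxa ▸ hx.2⟩
      · exact (hsub ⟨heC, hpe⟩).2 (hpe' ▸ hcC)
    · push Not at hex
      exact ⟨p, h, hex⟩

end DirectedCycle

variable {G H : MultiDigraph}

/-- The in-arcs of a vertex form one cycle of `q⁻¹ * p`; if there are only two, they are exchanged.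
-/
theorem IsTransitionPair.apply_eq_apply {p q : Perm G.E} (h : G.IsTransitionPair p q)
    (hG : G.InDegreeLeTwo) {x y : G.E} (hxy : G.tgt x = G.tgt y) (hne : x ≠ y) : p x = q y := by
  have hsc := (h.sameCycle_iff x y).2 hxy
  have hx : G.tgt x = G.tgt ((q⁻¹ * p) x) :=
    (h.sameCycle_iff _ _).1 (SameCycle.refl _ x).apply_right
  rcases hG x y _ hxy hx with h1 | h1 | h1
  · exact absurd h1 hne
  · exact absurd (SameCycle.eq_of_left hsc h1.symm) hne
  · rw [h1, Perm.mul_apply]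
    exact (apply_symm_apply _ _).symm

theorem mem_iff_of_forall_mem {X : Type*} [Finite X] {p : Perm X} {C : Set X}
    (h : ∀ x ∈ C, p x ∈ C) (x : X) : p x ∈ C ↔ x ∈ C := by
  refine ⟨fun hx => ?_, h x⟩
  obtain ⟨y, hy, hxy⟩ : ∃ y ∈ C, p y = p x := by
    have := Set.eq_of_subset_of_ncard_le (s := p '' C) (t := C)
      (by rintro _ ⟨y, hy, rfl⟩; exact h y hy)
      (by rw [Set.ncard_image_of_injective _ p.injective])
    rw [← this] at hx
    exact hx
  rwa [← p.injective hxy]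

/-- After the splitting process has been applied to `p` and then to `q`, both preserve `C`, hence
its complement. At a visited vertex `C` uses one of the at most two in-arcs, so at most one remains
and the restriction is again a transition pair. -/
theorem RemovesCycle.isDiplanar (h : G.RemovesCycle H) (hG : G.InDegreeLeTwo)
    (hd : G.IsDiplanar) : H.IsDiplanar := by
  obtain ⟨C, fV, fE, hC, hinj, hrange, hsrc, htgt⟩ := h
  obtain ⟨p, q, hpq, hs⟩ := (isDiplanar_iff G).1 hd
  have h0 : G.IsPartlySplit C p q := ⟨hs, hpq.src_apply, hpq.src_apply_right,
    fun x y hxy hne => Or.inl (hpq.apply_eq_apply hG hxy hne)⟩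
  obtain ⟨p', h1, hp'⟩ := h0.exists_left_invariant hC
  obtain ⟨q', h2, hq'⟩ := h1.symm.exists_left_invariant hC
  have hmem : ∀ x, x ∈ Set.range fE ↔ x ∉ C := fun x => by rw [hrange]; rfl
  refine isDiplanar_of_range_invariant H p' q' h2.spherical.symm fE hinj (fun x => ?_)
    (fun x => ?_) (fun a b hab => ?_) fun a b => ?_
  · rw [hmem, hmem, mem_iff_of_forall_mem hp']
  · rw [hmem, hmem, mem_iff_of_forall_mem hq']
  · apply fV.injective
    rw [hsrc, htgt, ← hab, h2.src_right]
  · have hiff : H.tgt a = H.tgt b ↔ G.tgt (fE a) = G.tgt (fE b) := by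
      rw [← htgt, ← htgt, fV.injective.eq_iff]
    rw [hiff]
    constructor
    · refine SameCycle.eq_of_invariant fun x => ?_
      rw [← h2.src_left, ← h2.src_right, Perm.mul_apply]
      exact congrArg _ (apply_symm_apply _ _)
    · intro hab
      by_cases hne : fE a = fE b
      · rw [hne]
      · rcases h2.symm.split _ _ hab hne with h3 | ⟨-, -, z, hz, hza⟩
        · exact ⟨1, by simp [h3]⟩
        · have ha := (hmem _).1 ⟨a, rfl⟩
          have hb := (hmem _).1 ⟨b, rfl⟩
          rcases hG _ _ _ hab hza.symm with h3 | h3 | h3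
          · exact absurd h3 hne
          · exact absurd (h3 ▸ hz) ha
          · exact absurd (h3 ▸ hz) hb

theorem IsDiplanar.of_iso (hd : G.IsDiplanar) (fV : H.V → G.V) (hV : Function.Injective fV)
    (fE : H.E ≃ G.E) (hsrc : ∀ a, fV (H.src a) = G.src (fE a))
    (htgt : ∀ a, fV (H.tgt a) = G.tgt (fE a)) : H.IsDiplanar := by
  obtain ⟨p, q, hpq, hs⟩ := (isDiplanar_iff G).1 hd
  refine isDiplanar_of_range_invariant H p q hs fE fE.injective (by simp) (by simp)
    (fun a b hab => ?_) fun a b => ?_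
  · apply hV
    rw [hsrc, htgt, ← hab, hpq.src_apply]
  · rw [hpq.sameCycle_iff, ← htgt, ← htgt, hV.eq_iff]

theorem DeletesIsolated.isDiplanar (h : G.DeletesIsolated H) (hd : G.IsDiplanar) :
    H.IsDiplanar := by
  obtain ⟨v, fV, fE, -, hinj, -, hsrc, htgt⟩ := h
  exact hd.of_iso fV hinj fE hsrc htgt

/-- The point `b` becomes a fixed point of both permutations, so each gains a cycle; this balances
the at most one additional orbit, while `q⁻¹ * p` is only conjugated. -/
theorem _root_.IsSpherical.mul_swap_mul_swap {X : Type*} [Finite X] [DecidableEq X]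
    {p q : Perm X} (hs : IsSpherical p q) {a b : X} (hab : a ≠ b) (hp : p a = b) (hq : q a = b) :
    IsSpherical (p * swap a b) (q * swap a b) := by
  have h1 := cycleCount_lt_mul_swap hab (p := p) ⟨1, by simpa using hp⟩
  have h2 := cycleCount_lt_mul_swap hab (p := q) ⟨1, by simpa using hq⟩
  have h3 : orbitCount (p * swap a b) (q * swap a b) ≤ orbitCount p q + 1 := by
    set p' := p * swap a b with hp'
    set q' := q * swap a b with hq'
    have e1 : ∀ x, p x = p' (swap a b x) := fun x => by simp [hp']
    have e2 : ∀ x, q x = q' (swap a b x) := fun x => by simp [hq']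
    obtain ⟨g, hg, hgab, hle⟩ := exists_merge (orbitClass p' q') a b
    conv_lhs => rw [orbitCount, ← ncard_range_of_surjective (orbitClass_surjective p' q')]
    refine hle.trans (Nat.add_le_add_right
      (ncard_range_le_orbitCount g (fun x => ?_) fun x => ?_) 1)
    · rw [e1, hg _ _ (orbitClass_left p' q' _), apply_swap_of_eq hgab]
    · rw [e2, hg _ _ (orbitClass_right p' q' _), apply_swap_of_eq hgab]
  have h4 : cycleCount (q⁻¹ * p) ≤ cycleCount ((q * swap a b)⁻¹ * (p * swap a b)) := by
    conv_lhs => rw [cycleCount, ← ncard_range_of_surjective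
      ((cycleClass_surjective (q⁻¹ * p)).comp (swap a b).surjective)]
    refine ncard_range_le_cycleCount _ fun x => ?_
    have : swap a b (((q * swap a b)⁻¹ * (p * swap a b)) x) = (q⁻¹ * p) (swap a b x) := by
      simp [mul_inv_rev]
    rw [Function.comp_apply, this, cycleClass_apply, Function.comp_apply]
  unfold IsSpherical at *
  omega

/-- Both transitions lead from `e` to `f`, the only out-arc at `v`. Multiplication by the
transposition fixes `f` and lets `e` continue as `f` did, so `f` can be discarded. -/
theorem SuppressesVertex.isDiplanar (h : G.SuppressesVertex H) (hd : G.IsDiplanar) :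
    H.IsDiplanar := by
  classical
  obtain ⟨v, e, f, fV, fE, hef, hin, hout, hVinj, -, hinj, hrange, hsrc, htgt⟩ := h
  obtain ⟨p, q, hpq, hs⟩ := (isDiplanar_iff G).1 hd
  have hpe : p e = f := (hout _).1 ((hpq.src_apply e).trans ((hin e).2 rfl))
  have hqe : q e = f := (hout _).1 ((hpq.src_apply_right e).trans ((hin e).2 rfl))
  have hmem : ∀ x, x ∈ Set.range fE ↔ x ≠ f := fun x => by rw [hrange]; rfl
  have hfix : ∀ r : Perm G.E, r e = f → ∀ x, (r * swap e f) x ≠ f ↔ x ≠ f := by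
    intro r hr x
    have : (r * swap e f) f = f := by simp [hr]
    exact not_congr ⟨fun h => (r * swap e f).injective (h.trans this.symm), fun h => h ▸ this⟩
  have htgt' : ∀ a, fV (H.tgt a) = G.tgt (swap e f (fE a)) := by
    intro a
    have ha := (hmem _).1 ⟨a, rfl⟩
    rw [htgt]
    split_ifs with hae
    · rw [hae, swap_apply_left]
    · rw [swap_apply_of_ne_of_ne hae ha]
  refine isDiplanar_of_range_invariant H _ _ (hs.mul_swap_mul_swap hef hpe hqe) fE hinj
    (fun x => ?_) (fun x => ?_) (fun a b hab => ?_) fun a b => ?_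
  · rw [hmem, hmem, hfix p hpe]
  · rw [hmem, hmem, hfix q hqe]
  · apply hVinj
    rw [hsrc, ← hab, htgt', Perm.mul_apply, hpq.src_apply]
  · rw [show (q * swap e f)⁻¹ * (p * swap e f) = swap e f * (q⁻¹ * p) * (swap e f)⁻¹ by
      simp [mul_inv_rev, mul_assoc], sameCycle_conj, hpq.sameCycle_iff, swap_inv, ← htgt',
      ← htgt', hVinj.eq_iff]

theorem inDegreeLeTwo_of_injective (hG : G.InDegreeLeTwo) (f : H.E → G.E)
    (hf : Function.Injective f) (h : ∀ a b, H.tgt a = H.tgt b → G.tgt (f a) = G.tgt (f b)) :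
    H.InDegreeLeTwo := by
  intro x y z hxy hxz
  simpa only [hf.eq_iff] using hG (f x) (f y) (f z) (h _ _ hxy) (h _ _ hxz)

theorem Reduces.inDegreeLeTwo (h : G.Reduces H) (hG : G.InDegreeLeTwo) : H.InDegreeLeTwo := by
  classical
  rcases h with ⟨C, fV, fE, -, hinj, -, -, htgt⟩ | ⟨v, fV, fE, -, hinj, -, -, htgt⟩ |
    ⟨v, e, f, fV, fE, hef, hin, hout, hVinj, -, hinj, hrange, hsrc, htgt⟩
  · exact inDegreeLeTwo_of_injective hG fE hinj fun a b hab => by rw [← htgt, ← htgt, hab]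
  · exact inDegreeLeTwo_of_injective hG fE fE.injective fun a b hab => by
      rw [← htgt, ← htgt, hab]
  · have htgt' : ∀ a, fV (H.tgt a) = G.tgt (swap e f (fE a)) := by
      intro a
      have ha : fE a ≠ f := by
        have : fE a ∈ Set.range fE := ⟨a, rfl⟩
        rwa [hrange] at this
      rw [htgt]
      split_ifs with hae
      · rw [hae, swap_apply_left]
      · rw [swap_apply_of_ne_of_ne hae ha]
    exact inDegreeLeTwo_of_injective hG (fun a => swap e f (fE a))
      ((swap e f).injective.comp hinj) fun a b hab => by rw [← htgt', ← htgt', hab]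

theorem Reduces.isDiplanar (h : G.Reduces H) (hG : G.InDegreeLeTwo) (hd : G.IsDiplanar) :
    H.IsDiplanar := by
  rcases h with h | h | h
  · exact h.isDiplanar hG hd
  · exact h.isDiplanar hd
  · exact h.isDiplanar hd

theorem IsQuarticEulerian.inDegreeLeTwo (hG : G.IsQuarticEulerian) : G.InDegreeLeTwo := by
  intro x y z hxy hxz
  by_contra! hc
  have h2 : ({x, y, z} : Set G.E).ncard = 3 := by
    rw [Set.ncard_eq_three]
    exact ⟨x, y, z, hc.1, hc.2.1, hc.2.2, rfl⟩
  have h3 : ({x, y, z} : Set G.E).ncard ≤ G.inDegree (G.tgt x) := by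
    refine Set.ncard_le_ncard ?_
    rintro w (rfl | rfl | rfl)
    · rfl
    · exact hxy.symm
    · exact hxz.symm
  rw [h2, (hG _).1] at h3
  omega

/-- The only reduction steps out of a quartic Eulerian digraph are removals of cycles. -/
theorem IsQuarticEulerian.removesCycle (hG : G.IsQuarticEulerian) (h : G.Reduces H) :
    G.RemovesCycle H := by
  rcases h with h | ⟨v, -, -, hv, -⟩ | ⟨v, e, f, -, -, -, hin, -⟩
  · exact h
  · have h1 := (hG v).1
    have h2 : {e : G.E | G.tgt e = v} = ∅ := by
      ext e
      simpa using (hv e).2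
    rw [inDegree, h2, Set.ncard_empty] at h1
    omega
  · have h1 := (hG v).1
    have h2 : {a : G.E | G.tgt a = v} = {e} := by
      ext a
      exact hin a
    rw [inDegree, h2, Set.ncard_singleton] at h1
    omega

/-- Every digraph below a quartic Eulerian digraph is diplanar if the removal of each directed
cycle leaves a diplanar digraph. -/
theorem IsQuarticEulerian.isDiplanar_of_strictlySmaller (hG : G.IsQuarticEulerian)
    (hC : ∀ C, G.IsDirectedCycle C → (G.deleteArcs C).IsDiplanar) (h : H.StrictlySmaller G) :
    H.IsDiplanar := by
  -- Intermediate digraphs need not be quartic Eulerian; the bound on in-degrees survives every step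
  -- and is what the removal of a cycle requires.
  suffices H.IsDiplanar ∧ H.InDegreeLeTwo from this.1
  induction h with
  | single h =>
    refine ⟨?_, h.inDegreeLeTwo hG.inDegreeLeTwo⟩
    obtain ⟨C, fV, fE, hcyc, hinj, hrange, hsrc, htgt⟩ := hG.removesCycle h
    have hmem : ∀ a, fE a ∉ C := fun a => by
      have : fE a ∈ Set.range fE := ⟨a, rfl⟩
      rwa [hrange] at this
    refine (hC C hcyc).of_iso fV fV.injective
      (Equiv.ofBijective (fun a => (⟨fE a, hmem a⟩ : {e : G.E // e ∉ C})) ⟨fun a b hab => ?_, ?_⟩)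
      hsrc htgt
    · exact hinj (congrArg Subtype.val hab)
    · rintro ⟨e, he⟩
      have : e ∈ Set.range fE := by rwa [hrange]
      obtain ⟨a, rfl⟩ := this
      exact ⟨a, rfl⟩
  | tail _ h ih => exact ⟨h.isDiplanar ih.2 ih.1, h.inDegreeLeTwo ih.2⟩

end MultiDigraph

/-! ### The digraph with steps `2` and `-1` is not diplanar -/

namespace MultiDigraph

/-- The digraph on `ℤ/n` with an arc `(m, true)` from `m` to `m + 2` and an arc `(m, false)` from
`m` to `m - 1`, for every `m`. -/
def stepDigraph (n : ℕ) [NeZero n] : MultiDigraph where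
  V := ZMod n
  E := ZMod n × Bool
  finV := inferInstance
  finE := inferInstance
  src e := e.1
  tgt e := if e.2 then e.1 + 2 else e.1 - 1

/-- The length of a step in `stepDigraph`. -/
def stepLength (b : Bool) : ℤ := if b then 2 else -1

theorem stepDigraph_tgt (n : ℕ) [NeZero n] (e : ZMod n × Bool) :
    (stepDigraph n).tgt e = e.1 + (stepLength e.2 : ZMod n) := by
  rcases e with ⟨m, _ | _⟩
  · change m - 1 = m + ((-1 : ℤ) : ZMod n)
    push_cast
    ring
  · change m + 2 = m + ((2 : ℤ) : ZMod n)
    push_cast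
    ring

theorem sum_stepLength {α : Type*} (s : Finset (α × Bool)) :
    ∑ e ∈ s, stepLength e.2 = 2 * (s.filter fun e => e.2 = true).card -
      (s.filter fun e => ¬ e.2 = true).card := by
  rw [← Finset.sum_filter_add_sum_filter_not s (fun e => e.2 = true)]
  rw [Finset.sum_congr rfl (g := fun _ => (2 : ℤ)),
    Finset.sum_congr rfl (s₁ := s.filter fun e => ¬ e.2 = true) (g := fun _ => (-1 : ℤ))]
  · simp
    ring
  · intro x hx
    simp [stepLength, (Finset.mem_filter.1 hx).2]
  · intro x hx
    simp [stepLength, (Finset.mem_filter.1 hx).2]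

/-- If `x + y ≤ 2`, then `2x - y` lies between `-2` and `4`, so it vanishes; but then `x + y = 3x`.
-/
theorem three_le_of_dvd {n : ℕ} (hn : 5 ≤ n) {x y : ℕ} (hd : (n : ℤ) ∣ 2 * x - y)
    (hpos : 0 < x + y) : 3 ≤ x + y := by
  by_contra! hlt
  have h0 : (2 * x - y : ℤ) = 0 := by
    refine Int.eq_zero_of_abs_lt_dvd hd ?_
    rw [abs_lt]
    omega
  omega

/-- If `y ≥ 1`, then `2x ≥ n + y` gives the bound. If `y = 0`, oddness of `n` gives `n ∣ x`. -/
theorem long_of_dvd {n : ℕ} (hn : 5 ≤ n) (hodd : Odd n) {x y : ℕ} (hd : (n : ℤ) ∣ 2 * x - y)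
    (hpos : (0 : ℤ) < 2 * x - y) : n + 3 ≤ 2 * (x + y) := by
  have h1 := Int.le_of_dvd hpos hd
  rcases Nat.eq_zero_or_pos y with rfl | hy
  · have h2 : n ∣ 2 * x := by
      have : ((n : ℕ) : ℤ) ∣ ((2 * x : ℕ) : ℤ) := by simpa using hd
      exact_mod_cast this
    have h3 : n ∣ x := (Nat.Coprime.dvd_mul_left hodd.coprime_two_right).1 h2
    have h4 := Nat.le_of_dvd (by omega) h3
    omega
  · omega

/-- A partition of the arcs of `stepDigraph n` into closed walks has at most `(n + 1) / 2` parts: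
every part has length at least three, and one of them winds around. -/
theorem two_mul_cycleCount_le {n : ℕ} [NeZero n] (hn : 5 ≤ n) (hodd : Odd n)
    (p : Perm (ZMod n × Bool)) (hp : ∀ e, (p e).1 = e.1 + (stepLength e.2 : ZMod n)) :
    2 * cycleCount p ≤ n + 1 := by
  classical
  have : Fintype (Quotient (SameCycle.setoid p)) := Fintype.ofFinite _
  let F : Quotient (SameCycle.setoid p) → Finset (ZMod n × Bool) :=
    fun y => Finset.univ.filter fun e => cycleClass p e = y
  have hF : ∀ y e, e ∈ F y ↔ cycleClass p e = y := by simp [F]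
  -- The displacements `(p e).1 - e.1` cancel over a cycle of `p`.
  have hdvd : ∀ y, (n : ℤ) ∣ ∑ e ∈ F y, stepLength e.2 := by
    intro y
    rw [← ZMod.intCast_zmod_eq_zero_iff_dvd, Int.cast_sum]
    have h1 : ∑ e ∈ F y, (stepLength e.2 : ZMod n) = ∑ e ∈ F y, ((p e).1 - e.1) :=
      Finset.sum_congr rfl fun e _ => by rw [hp]; ring
    have h2 : ∑ e ∈ F y, (p e).1 = ∑ e ∈ F y, e.1 :=
      Finset.sum_equiv p (fun e => by rw [hF, hF, cycleClass_apply]) fun _ _ => rfl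
    rw [h1, Finset.sum_sub_distrib, h2, sub_self]
  let x : Quotient (SameCycle.setoid p) → ℕ := fun y => ((F y).filter fun e => e.2 = true).card
  let z : Quotient (SameCycle.setoid p) → ℕ := fun y => ((F y).filter fun e => ¬ e.2 = true).card
  have hxz : ∀ y, x y + z y = (F y).card := fun y => Finset.card_filter_add_card_filter_not _
  have hlen : ∀ y, 3 ≤ (F y).card := by
    intro y
    rw [← hxz]
    refine three_le_of_dvd hn (by rw [← sum_stepLength]; exact hdvd y) ?_
    obtain ⟨e, he⟩ := cycleClass_surjective p y
    rw [hxz]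
    exact Finset.card_pos.2 ⟨e, (hF y e).2 he⟩
  have htot : ∑ y, (F y).card = 2 * n := by
    have := Finset.card_eq_sum_card_fiberwise (f := cycleClass p)
      (s := (Finset.univ : Finset (ZMod n × Bool))) (t := Finset.univ) (by simp)
    rw [← this, Finset.card_univ, Fintype.card_prod, ZMod.card, Fintype.card_bool, mul_comm]
  have hsum : ∑ y, ∑ e ∈ F y, stepLength e.2 = n := by
    rw [Finset.sum_fiberwise, Fintype.sum_prod_type]
    simp [stepLength, ZMod.card]
  obtain ⟨y₀, -, hy₀⟩ : ∃ y ∈ Finset.univ, 0 < ∑ e ∈ F y, stepLength e.2 := by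
    by_contra! hc
    have := Finset.sum_nonpos hc
    omega
  have hlong : n + 3 ≤ 2 * (F y₀).card := by
    rw [← hxz]
    refine long_of_dvd hn hodd ?_ ?_ <;> rw [← sum_stepLength]
    · exact hdvd y₀
    · exact hy₀
  have hcard : cycleCount p = (Finset.univ.erase y₀).card + 1 := by
    rw [Finset.card_erase_add_one (Finset.mem_univ _), Finset.card_univ, cycleCount,
      Nat.card_eq_fintype_card]
  have hrest : (Finset.univ.erase y₀).card * 3 ≤ ∑ y ∈ Finset.univ.erase y₀, (F y).card := by
    rw [← smul_eq_mul]
    exact Finset.card_nsmul_le_sum _ _ _ fun y _ => hlen y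
  -- With `c` cycles, `2n ≥ (n + 3) / 2 + 3 (c - 1)`, which is `2c ≤ n + 1`.
  have := Finset.add_sum_erase Finset.univ (fun y => (F y).card) (Finset.mem_univ y₀)
  simp only [htot] at this
  omega

/-- With at most `n` vertex cycles, `2n` arcs and at least one orbit, genus zero would force `n + 2`
facial walks; the two orientations supply at most `n + 1`. -/
theorem not_isDiplanar_stepDigraph {n : ℕ} [NeZero n] (hn : 5 ≤ n) (hodd : Odd n) :
    ¬ (stepDigraph n).IsDiplanar := by
  intro hd
  obtain ⟨p, q, hpq, hs⟩ := (isDiplanar_iff _).1 hd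
  have h1 := two_mul_cycleCount_le hn hodd p fun e => by
    rw [← stepDigraph_tgt]
    exact hpq.src_apply e
  have h2 := two_mul_cycleCount_le hn hodd q fun e => by
    rw [← stepDigraph_tgt]
    exact hpq.src_apply_right e
  have h3 := hpq.card_vertices
  have h4 : Nat.card (stepDigraph n).V = n := Nat.card_zmod n
  have h5 : Nat.card (stepDigraph n).E = 2 * n := by
    change Nat.card (ZMod n × Bool) = 2 * n
    simp [mul_comm]
  have h6 : 0 < orbitCount p q := by
    have : Nonempty (Quot fun x y => y = p x ∨ y = q x) :=
      ⟨orbitClass p q ((0 : ZMod n), true)⟩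
    exact Nat.card_pos
  unfold IsSpherical at hs
  rw [h5] at hs
  have h1' : 2 * cycleCount (X := (stepDigraph n).E) p ≤ n + 1 := h1
  have h2' : 2 * cycleCount (X := (stepDigraph n).E) q ≤ n + 1 := h2
  omega

end MultiDigraph

/-! ### Transitions that respect a removed cycle, and its winding number -/

namespace MultiDigraph

variable {n : ℕ}

/-- The transitions of `stepDigraph n` that change the type of the arc at the vertices where `s` is
true, and keep it at the others. -/
def turnPerm (s : ZMod n → Bool) : Perm (ZMod n × Bool) where
  toFun e := if e.2 then (e.1 + 2, !(s (e.1 + 2))) else (e.1 - 1, s (e.1 - 1))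
  invFun e := if (e.2 ^^ s e.1) then (e.1 - 2, true) else (e.1 + 1, false)
  left_inv := by rintro ⟨m, _ | _⟩ <;> simp
  right_inv := by
    rintro ⟨m, b⟩
    cases b <;> cases h : s m <;> simp [h]

theorem turnPerm_true (s : ZMod n → Bool) (m : ZMod n) :
    turnPerm s (m, true) = (m + 2, !(s (m + 2))) := rfl

theorem turnPerm_false (s : ZMod n → Bool) (m : ZMod n) :
    turnPerm s (m, false) = (m - 1, s (m - 1)) := rfl

/-- The arc set `C` passes through `w`. -/
def Visits (C : Set (ZMod n × Bool)) (w : ZMod n) : Prop := (w, true) ∈ C ∨ (w, false) ∈ C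

/-- The arc set `C` passes through `w` by two arcs of the same type. -/
def GoesStraight (C : Set (ZMod n × Bool)) (w : ZMod n) : Prop :=
  ((w - 2, true) ∈ C ∧ (w, true) ∈ C) ∨ ((w + 1, false) ∈ C ∧ (w, false) ∈ C)

open Classical in
/-- The type of the transition at each vertex that keeps `C` invariant, with a free
choice `f` at the vertices outside `C`. -/
noncomputable def turnAt (C : Set (ZMod n × Bool)) (f : ZMod n → Bool) (w : ZMod n) : Bool :=
  if Visits C w then decide (¬ GoesStraight C w) else f w

theorem turnAt_of_visits {C : Set (ZMod n × Bool)} {w : ZMod n} (h : Visits C w)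
    (f g : ZMod n → Bool) : turnAt C f w = turnAt C g w := by
  simp [turnAt, h]

theorem turnAt_of_not_visits {C : Set (ZMod n × Bool)} {w : ZMod n} (h : ¬ Visits C w)
    (f : ZMod n → Bool) : turnAt C f w = f w := by
  simp [turnAt, h]

/-- The set `C` has at each vertex as many in-arcs as out-arcs, and at most one. -/
structure IsUnitFlow (C : Set (ZMod n × Bool)) : Prop where
  out_le : ∀ w, ¬ ((w, true) ∈ C ∧ (w, false) ∈ C)
  in_le : ∀ w, ¬ ((w - 2, true) ∈ C ∧ (w + 1, false) ∈ C)
  conserved : ∀ w, Visits C w ↔ ((w - 2, true) ∈ C ∨ (w + 1, false) ∈ C)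

open Classical in
/-- The number of copies of an arc in `C`. -/
noncomputable def mult (C : Set (ZMod n × Bool)) (b : Bool) (m : ZMod n) : ℤ :=
  if (m, b) ∈ C then 1 else 0

theorem mult_cases (C : Set (ZMod n × Bool)) (b : Bool) (m : ZMod n) :
    ((m, b) ∈ C ∧ mult C b m = 1) ∨ ((m, b) ∉ C ∧ mult C b m = 0) := by
  by_cases h : (m, b) ∈ C <;> simp [mult, h]

variable [NeZero n]

theorem src_turnPerm (s : ZMod n → Bool) (e : ZMod n × Bool) :
    (turnPerm s e).1 = (stepDigraph n).tgt e := by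
  rcases e with ⟨m, _ | _⟩ <;> rfl

theorem stepDigraph_tgt_eq_iff (e : ZMod n × Bool) (w : ZMod n) :
    (stepDigraph n).tgt e = w ↔ e = (w - 2, true) ∨ e = (w + 1, false) := by
  rcases e with ⟨m, _ | _⟩
  · change m - 1 = w ↔ _
    simp [sub_eq_iff_eq_add]
  · change m + 2 = w ↔ _
    simp [eq_sub_iff_add_eq]

theorem IsDirectedCycle.isUnitFlow {C : Set (ZMod n × Bool)}
    (hC : (stepDigraph n).IsDirectedCycle C) : IsUnitFlow C := by
  refine ⟨fun w h => ?_, fun w h => ?_, fun w => ⟨?_, ?_⟩⟩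
  · have := hC.src_injOn h.1 h.2 rfl
    exact Bool.noConfusion (congrArg Prod.snd this)
  · have := hC.tgt_injOn h.1 h.2
      (((stepDigraph_tgt_eq_iff _ w).2 (Or.inl rfl)).trans
        ((stepDigraph_tgt_eq_iff _ w).2 (Or.inr rfl)).symm)
    exact Bool.noConfusion (congrArg Prod.snd this)
  · rintro (h | h) <;>
    · obtain ⟨y, hy, hyw⟩ := hC.exists_tgt_eq_src h
      rcases (stepDigraph_tgt_eq_iff y w).1 hyw with rfl | rfl
      · exact Or.inl hy
      · exact Or.inr hy
  · have key : ∀ e ∈ C, (stepDigraph n).tgt e = w → Visits C w := by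
      intro e he hw
      obtain ⟨⟨y, b⟩, hy, hyw⟩ := hC.exists_src_eq_tgt he
      obtain rfl : y = w := hyw.trans hw
      cases b
      · exact Or.inr hy
      · exact Or.inl hy
    rintro (h | h)
    · exact key _ h ((stepDigraph_tgt_eq_iff _ w).2 (Or.inl rfl))
    · exact key _ h ((stepDigraph_tgt_eq_iff _ w).2 (Or.inr rfl))

namespace IsUnitFlow

variable {C : Set (ZMod n × Bool)}

/-- At a visited vertex the transition joins the entering arc of `C` to the leaving one, and so
joins the two other arcs as well. At any other vertex no incident arc is in `C`. -/
theorem turnPerm_mem_iff (hC : IsUnitFlow C) (f : ZMod n → Bool) (e : ZMod n × Bool) :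
    turnPerm (turnAt C f) e ∈ C ↔ e ∈ C := by
  classical
  obtain ⟨w, hw⟩ : ∃ w : ZMod n, (stepDigraph n).tgt e = w := ⟨_, rfl⟩
  have h1 := hC.out_le w
  have h2 := hC.in_le w
  have h3 := hC.conserved w
  have hv : Visits C w ↔ (w, true) ∈ C ∨ (w, false) ∈ C := Iff.rfl
  have hs : GoesStraight C w ↔
    ((w - 2, true) ∈ C ∧ (w, true) ∈ C) ∨ ((w + 1, false) ∈ C ∧ (w, false) ∈ C) := Iff.rfl
  have ht : turnAt C f w = if Visits C w then decide (¬ GoesStraight C w) else f w := by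
    simp only [turnAt]
  rcases (stepDigraph_tgt_eq_iff e w).1 hw with rfl | rfl
  · rw [turnPerm_true, sub_add_cancel]
    by_cases hV : Visits C w
    · by_cases hS : GoesStraight C w
      · simp only [ht, hV, hS, if_true, not_true, decide_false, Bool.not_false]
        tauto
      · simp only [ht, hV, hS, if_true, not_false_eq_true, decide_true, Bool.not_true]
        tauto
    · have : ∀ b, (w, b) ∉ C := by rintro (_ | _) <;> tauto
      simp only [this, false_iff]
      tauto
  · rw [turnPerm_false, add_sub_cancel_right]
    by_cases hV : Visits C w
    · by_cases hS : GoesStraight C w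
      · simp only [ht, hV, hS, if_true, not_true, decide_false]
        tauto
      · simp only [ht, hV, hS, if_true, not_false_eq_true, decide_true]
        tauto
    · have : ∀ b, (w, b) ∉ C := by rintro (_ | _) <;> tauto
      simp only [this, false_iff]
      tauto

/-- The transitions of `stepDigraph n - C` given by a choice at the vertices outside `C`. -/
noncomputable def transition (hC : IsUnitFlow C) (f : ZMod n → Bool) :
    Perm ((stepDigraph n).deleteArcs C).E :=
  (turnPerm (turnAt C f)).subtypePerm (p := fun e => e ∉ C)
    fun e => not_congr (hC.turnPerm_mem_iff f e)

theorem transition_val (hC : IsUnitFlow C) (f : ZMod n → Bool)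
    (e : ((stepDigraph n).deleteArcs C).E) :
    (hC.transition f e).1 = turnPerm (turnAt C f) e.1 := rfl

theorem eq_of_tgt_eq (hC : IsUnitFlow C) {w : ZMod n} (hw : Visits C w) {x y : ZMod n × Bool}
    (hx : x ∉ C) (hy : y ∉ C) (hxw : (stepDigraph n).tgt x = w) (hyw : (stepDigraph n).tgt y = w) :
    x = y := by
  have := (hC.conserved w).1 hw
  rcases (stepDigraph_tgt_eq_iff x w).1 hxw with rfl | rfl <;>
  rcases (stepDigraph_tgt_eq_iff y w).1 hyw with rfl | rfl <;> tauto

/-- At a visited vertex a single in-arc remains; elsewhere `f` and its negation join in-arcs to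
out-arcs in the two opposite ways. -/
theorem isTransitionPair (hC : IsUnitFlow C) (f : ZMod n → Bool) :
    ((stepDigraph n).deleteArcs C).IsTransitionPair (hC.transition f)
      (hC.transition fun w => !(f w)) := by
  have hsrc : ∀ (f : ZMod n → Bool) e, ((stepDigraph n).deleteArcs C).src (hC.transition f e) =
      ((stepDigraph n).deleteArcs C).tgt e := fun f e => src_turnPerm _ _
  refine ⟨hsrc f, fun e e' => ⟨?_, fun h => ?_⟩⟩
  · refine SameCycle.eq_of_invariant fun x => ?_
    rw [← hsrc fun w => !(f w), ← hsrc f, Perm.mul_apply]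
    exact congrArg _ (apply_symm_apply _ _)
  · obtain ⟨w, hw⟩ : ∃ w : ZMod n, (stepDigraph n).tgt e.1 = w := ⟨_, rfl⟩
    have hw' : (stepDigraph n).tgt e'.1 = w := Eq.trans h.symm hw
    by_cases hne : e = e'
    · rw [hne]
    have hV : ¬ Visits C w := fun hV => hne (Subtype.ext (hC.eq_of_tgt_eq hV e.2 e'.2 hw hw'))
    refine ⟨1, ?_⟩
    rw [zpow_one, Perm.mul_apply]
    refine (symm_apply_eq _).2 (Subtype.ext ?_)
    rw [transition_val, transition_val]
    rcases (stepDigraph_tgt_eq_iff _ w).1 hw with h1 | h1 <;>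
    rcases (stepDigraph_tgt_eq_iff _ w).1 hw' with h2 | h2
    · exact absurd (Subtype.ext (h1.trans h2.symm)) hne
    · rw [h1, h2, turnPerm_true, turnPerm_false, sub_add_cancel, add_sub_cancel_right,
        turnAt_of_not_visits hV, turnAt_of_not_visits hV]
    · rw [h1, h2, turnPerm_true, turnPerm_false, sub_add_cancel, add_sub_cancel_right,
        turnAt_of_not_visits hV, turnAt_of_not_visits hV, Bool.not_not]
    · exact absurd (Subtype.ext (h1.trans h2.symm)) hne

theorem ncard_isIsolated (hC : IsUnitFlow C) :
    {v | ((stepDigraph n).deleteArcs C).IsIsolated v}.ncard = 0 := by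
  rw [Set.ncard_eq_zero, Set.eq_empty_iff_forall_notMem]
  intro (w : ZMod n) hw
  have h := hC.in_le w
  by_cases h1 : ((w - 2, true) : ZMod n × Bool) ∈ C
  · exact (hw ⟨(w + 1, false), fun h2 => h ⟨h1, h2⟩⟩).2
      ((stepDigraph_tgt_eq_iff _ w).2 (Or.inr rfl))
  · exact (hw ⟨(w - 2, true), h1⟩).2 ((stepDigraph_tgt_eq_iff _ w).2 (Or.inl rfl))

/-- To embed `stepDigraph n - C` it suffices to find enough facial walks. -/
theorem isDiplanar_of_le (hC : IsUnitFlow C) (f : ZMod n → Bool)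
    (h : Nat.card {e : ZMod n × Bool // e ∉ C} + 2 * ((stepDigraph n).deleteArcs C).numComponents ≤
      cycleCount (hC.transition f) + cycleCount (hC.transition fun w => !(f w)) + n) :
    ((stepDigraph n).deleteArcs C).IsDiplanar := by
  have hp := hC.isTransitionPair f
  refine (isDiplanar_iff _).2 ⟨_, _, hp, ?_⟩
  have h1 := hp.card_vertices
  have h2 := hp.numComponents_eq
  rw [hC.ncard_isIsolated] at h1 h2
  have h3 : Nat.card ((stepDigraph n).deleteArcs C).V = n := Nat.card_zmod n
  have h4 : Nat.card ((stepDigraph n).deleteArcs C).E = Nat.card {e : ZMod n × Bool // e ∉ C} := rfl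
  unfold IsSpherical
  omega

/-- No choice is left, so the two permutations coincide: the rest is a disjoint union of directed
cycles. -/
theorem isDiplanar_of_forall_visits (hC : IsUnitFlow C) (h : ∀ w, Visits C w) :
    ((stepDigraph n).deleteArcs C).IsDiplanar := by
  have hp := hC.isTransitionPair fun _ => true
  refine (isDiplanar_iff _).2 ⟨_, _, hp, ?_⟩
  have : hC.transition (fun _ => !true) = hC.transition fun _ => true := by
    unfold transition
    congr 2
    ext w
    exact turnAt_of_visits (h w) _ _
  rw [this]
  exact isSpherical_self _

theorem orbitCount_eq (hC : IsUnitFlow C) (f : ZMod n → Bool) :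
    orbitCount (hC.transition f) (hC.transition fun w => !(f w)) =
      ((stepDigraph n).deleteArcs C).numComponents := by
  have := (hC.isTransitionPair f).numComponents_eq
  rw [hC.ncard_isIsolated] at this
  omega

/-- The winding number of `C`. -/
theorem exists_winding (hC : IsUnitFlow C) :
    ∃ t : ℤ, ∀ m, mult C true (m - 1) + mult C true m - mult C false (m + 1) = t := by
  -- The expression counts the crossings of the cut between `m` and `m + 1` with sign; conservation
  -- at `m + 1` makes adjacent cuts agree.
  have hstep : ∀ m, mult C true (m + 1 - 1) + mult C true (m + 1) - mult C false (m + 1 + 1) =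
      mult C true (m - 1) + mult C true m - mult C false (m + 1) := by
    intro m
    have h1 := hC.out_le (m + 1)
    have h2 := hC.in_le (m + 1)
    have h3 := hC.conserved (m + 1)
    unfold Visits at h3
    rw [show m + 1 - 2 = m - 1 by ring] at h2 h3
    rw [add_sub_cancel_right]
    rcases mult_cases C true (m + 1) with ⟨h, e⟩ | ⟨h, e⟩ <;>
    rcases mult_cases C true (m - 1) with ⟨h', e'⟩ | ⟨h', e'⟩ <;>
    rcases mult_cases C false (m + 1) with ⟨h'', e''⟩ | ⟨h'', e''⟩ <;>
    rcases mult_cases C false (m + 1 + 1) with ⟨h''', e'''⟩ | ⟨h''', e'''⟩ <;>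
    first | (exfalso; tauto) | (rw [e, e', e'', e''']; ring)
  refine ⟨mult C true (0 - 1) + mult C true 0 - mult C false (0 + 1), fun m => ?_⟩
  have hk : ∀ k : ℕ, mult C true ((k : ZMod n) - 1) + mult C true k - mult C false (k + 1) =
      mult C true (0 - 1) + mult C true 0 - mult C false (0 + 1) := by
    intro k
    induction k with
    | zero => simp
    | succ k ih =>
      push_cast
      rw [hstep, ih]
  simpa using hk m.val

end IsUnitFlow

end MultiDigraph

/-! ### Winding number one, and preparations for the triangle -/

namespace MultiDigraph

variable {n : ℕ}

open Classical in
/-- The facial walks of a necklace of digons, labelled by the vertices between its beads. -/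
noncomputable def digonLabel (C : Set (ZMod n × Bool)) (e : ZMod n × Bool) : ZMod n :=
  if e.2 then e.1 + 1 else
    if (e.1 - 2, true) ∈ C ∧ (e.1, true) ∈ C then e.1 else e.1 - 1

/-- The arcs outside `C` decompose into triangles `c - 1 → c + 1 → c → c - 1`, one for each missing
arc `c - 1 → c + 1`, where `C` passes through `c` by `c - 2 → c → c + 2`. The transitions turn at `c
+ 1` and `c - 1` and go straight at `c`, so each triangle is a facial walk, with label `c`. -/
theorem IsUnitFlow.digonLabel_turnPerm {C : Set (ZMod n × Bool)} (hC : IsUnitFlow C)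
    (ht : ∀ m, mult C true (m - 1) + mult C true m - mult C false (m + 1) = 1)
    {e : ZMod n × Bool} (he : e ∉ C) :
    digonLabel C (turnPerm (turnAt C fun _ => true) e) = digonLabel C e := by
  classical
  have turn : ∀ w, ¬ GoesStraight C w → turnAt C (fun _ => true) w = true := by
    intro w hw
    by_cases hV : Visits C w <;> simp [turnAt, hV, hw]
  rcases e with ⟨m, _ | _⟩
  · rw [turnPerm_false]
    have h1 := ht (m - 1)
    have h2 := ht m
    rw [sub_add_cancel, show m - 1 - 1 = m - 2 by ring] at h1
    by_cases hs : (m - 2, true) ∈ C ∧ (m, true) ∈ C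
    · have h3 : (m - 1, true) ∉ C := by
        rcases mult_cases C true (m - 1) with ⟨h, e1⟩ | ⟨h, e1⟩
        · rcases mult_cases C true (m - 2) with ⟨h', e2⟩ | ⟨h', e2⟩
          · rcases mult_cases C false m with ⟨h'', e3⟩ | ⟨h'', e3⟩
            · exact absurd h'' he
            · omega
          · exact absurd hs.1 h'
        · exact h
      have hns : ¬ GoesStraight C (m - 1) := by
        rintro (h | h)
        · exact h3 h.2
        · rw [sub_add_cancel] at h
          exact he h.1
      rw [turn _ hns]
      simp [digonLabel, hs]
    · have h3 : (m - 1, true) ∈ C := by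
        rcases mult_cases C true (m - 1) with ⟨h, e1⟩ | ⟨h, e1⟩
        · exact h
        · exfalso
          rcases mult_cases C true (m - 2) with ⟨h', e2⟩ | ⟨h', e2⟩ <;>
          rcases mult_cases C true m with ⟨h'', e3⟩ | ⟨h'', e3⟩ <;>
          rcases mult_cases C false m with ⟨h3, e4⟩ | ⟨h3, e4⟩ <;>
          rcases mult_cases C false (m + 1) with ⟨h4, e5⟩ | ⟨h4, e5⟩ <;>
          first | omega | tauto
      have h4 : (m - 1 - 2, true) ∈ C := by
        rcases (hC.conserved (m - 1)).1 (Or.inl h3) with h | h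
        · exact h
        · rw [sub_add_cancel] at h
          exact absurd h he
      have hst : turnAt C (fun _ => true) (m - 1) = false := by
        have hV : Visits C (m - 1) := Or.inl h3
        have hS : GoesStraight C (m - 1) := Or.inl ⟨h4, h3⟩
        simp [turnAt, hV, hS]
      rw [hst]
      simp [digonLabel, hs, h3, h4]
  · rw [turnPerm_true]
    have hns : ¬ GoesStraight C (m + 2) := by
      rintro (h | h)
      · rw [add_sub_cancel_right] at h
        exact he h.1
      · have h1 := ht (m + 2)
        have h2 := hC.out_le (m + 2)
        rcases mult_cases C true (m + 2) with ⟨h', e2⟩ | ⟨h', e2⟩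
        · exact h2 ⟨h', h.2⟩
        · rcases mult_cases C false (m + 2 + 1) with ⟨h'', e3⟩ | ⟨h'', e3⟩
          · rcases mult_cases C true (m + 2 - 1) with ⟨h3, e4⟩ | ⟨h3, e4⟩ <;> omega
          · exact h'' h.1
    rw [turn _ hns]
    have h3 : ((m + 2 - 2, true) : ZMod n × Bool) ∉ C := by rwa [add_sub_cancel_right]
    simp only [digonLabel, h3, false_and, Bool.not_true, if_true, if_false, Bool.false_eq_true]
    ring

/-- The arcs of the directed triangle `i → i + 2 → i + 1 → i`. -/
def triangle (i : ZMod n) : Set (ZMod n × Bool) := {(i, true), (i + 2, false), (i + 1, false)}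

theorem true_mem_triangle (i m : ZMod n) : (m, true) ∈ triangle i ↔ (m - i).val = 0 := by
  simp [triangle, sub_eq_zero]

variable [NeZero n]

theorem quot_eq_of_notMem {C : Set (ZMod n × Bool)} {e : ZMod n × Bool} (he : e ∉ C)
    {u v : ZMod n} (hu : e.1 = u) (hv : (stepDigraph n).tgt e = v) :
    Quot.mk (fun u v : ((stepDigraph n).deleteArcs C).V =>
      ∃ e, ((stepDigraph n).deleteArcs C).src e = u ∧ ((stepDigraph n).deleteArcs C).tgt e = v) u =
    Quot.mk _ v :=
  Quot.sound ⟨⟨e, he⟩, hu, hv⟩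

/-- If `C` contains an arc `m → m - 1`, then every component of the rest contains the tail
of such an arc. -/
theorem numComponents_le (C : Set (ZMod n × Bool)) {m₀ : ZMod n} (h₀ : (m₀, false) ∈ C) :
    ((stepDigraph n).deleteArcs C).numComponents ≤ {m : ZMod n | (m, false) ∈ C}.ncard := by
  rw [numComponents, ← Nat.card_coe_set_eq]
  let g : {m : ZMod n | (m, false) ∈ C} → Quot fun u v : ((stepDigraph n).deleteArcs C).V =>
      ∃ e, ((stepDigraph n).deleteArcs C).src e = u ∧ ((stepDigraph n).deleteArcs C).tgt e = v :=
    fun m => Quot.mk _ m.1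
  refine Nat.card_le_card_of_surjective g ?_
  rintro ⟨(w : ZMod n)⟩
  -- Climbing from `m₀`: the arc from `m₀ + k + 1` down to `m₀ + k` either remains and joins the two
  -- vertices, or lies in `C` and has the new vertex as its tail.
  have key : ∀ k : ℕ, ∃ m, g m = Quot.mk _ (m₀ + k) := by
    intro k
    induction k with
    | zero => exact ⟨⟨m₀, h₀⟩, congrArg (Quot.mk _) (show m₀ = m₀ + ((0 : ℕ) : ZMod n) by simp)⟩
    | succ k ih =>
      by_cases hb : (m₀ + (k + 1 : ℕ), false) ∈ C
      · exact ⟨⟨_, hb⟩, rfl⟩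
      · obtain ⟨m, hm⟩ := ih
        refine ⟨m, hm.trans (quot_eq_of_notMem hb rfl ?_).symm⟩
        change m₀ + (k + 1 : ℕ) - 1 = m₀ + k
        push_cast
        ring
  obtain ⟨m, hm⟩ := key (ZMod.val (w - m₀))
  refine ⟨m, hm.trans (congrArg (Quot.mk _) ?_)⟩
  rw [ZMod.natCast_zmod_val, add_sub_cancel]

theorem card_notMem_le (C : Set (ZMod n × Bool)) :
    Nat.card {e : ZMod n × Bool // e ∉ C} ≤
      {m : ZMod n | (m, true) ∉ C}.ncard + {m : ZMod n | (m, false) ∉ C}.ncard := by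
  rw [← Nat.card_coe_set_eq, ← Nat.card_coe_set_eq, ← Nat.card_sum]
  refine Nat.card_le_card_of_surjective (Sum.elim (fun m => ⟨(m.1, true), m.2⟩)
    fun m => ⟨(m.1, false), m.2⟩) ?_
  rintro ⟨⟨m, _ | _⟩, h⟩
  · exact ⟨Sum.inr ⟨m, h⟩, rfl⟩
  · exact ⟨Sum.inl ⟨m, h⟩, rfl⟩

namespace IsUnitFlow

variable {C : Set (ZMod n × Bool)}

/-- Otherwise `C` would contain exactly one of any two consecutive arcs `m - 1 → m + 1` and `m → m +
2`, which is impossible around an odd circle. -/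
theorem exists_false_mem (hodd : Odd n)
    (ht : ∀ m, mult C true (m - 1) + mult C true m - mult C false (m + 1) = 1) :
    ∃ m, (m, false) ∈ C := by
  by_contra! hc
  have h0 : ∀ m, mult C false m = 0 := fun m => by simp [mult, hc m]
  have h1 : ∑ m : ZMod n, (mult C true (m - 1) + mult C true m) = n := by
    have : ∀ m, mult C true (m - 1) + mult C true m = 1 := fun m => by
      have := ht m
      rw [h0] at this
      omega
    simp [this, ZMod.card]
  have h2 : ∑ m : ZMod n, mult C true (m - 1) = ∑ m, mult C true m :=
    Fintype.sum_equiv (Equiv.subRight 1) _ _ fun _ => rfl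
  rw [Finset.sum_add_distrib, h2] at h1
  obtain ⟨k, hk⟩ := hodd
  omega

/-- After the removal of a cycle of winding number one there remain chains of digons. -/
theorem isDiplanar_of_winding_one (hC : IsUnitFlow C) (hodd : Odd n)
    (ht : ∀ m, mult C true (m - 1) + mult C true m - mult C false (m + 1) = 1) :
    ((stepDigraph n).deleteArcs C).IsDiplanar := by
  refine hC.isDiplanar_of_le (fun _ => true) ?_
  obtain ⟨m₀, h₀⟩ := exists_false_mem hodd ht
  have h1 := numComponents_le C h₀
  have h2 := card_notMem_le C
  have h3 := orbitCount_le_cycleCount_right (hC.transition fun _ => true)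
    (hC.transition fun _ => !true)
  rw [hC.orbitCount_eq fun _ => true] at h3
  have h4 : {m : ZMod n | (m, true) ∉ C}.ncard ≤ cycleCount (hC.transition fun _ => true) := by
    have h5 := ncard_range_le_cycleCount (p := hC.transition fun _ => true)
      (fun e : ((stepDigraph n).deleteArcs C).E => digonLabel C e.1)
      fun e => hC.digonLabel_turnPerm ht e.2
    refine le_trans ?_ h5
    rw [← Set.ncard_image_of_injective _ (add_left_injective (1 : ZMod n))]
    refine Set.ncard_le_ncard ?_ (Set.toFinite _)
    rintro _ ⟨m, hm, rfl⟩
    exact ⟨⟨(m, true), hm⟩, rfl⟩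
  have h6 : {m : ZMod n | (m, false) ∈ C}.ncard + {m : ZMod n | (m, false) ∉ C}.ncard = n := by
    exact (Set.ncard_add_ncard_compl {m : ZMod n | (m, false) ∈ C}).trans (Nat.card_zmod n)
  -- With `a` arcs `m → m + 2` outside `C`, `b` arcs `m → m - 1` in `C` and `c` components, it
  -- suffices that `a + (n - b) + 2c ≤ a + c + n`, that is `c ≤ b`.
  omega

end IsUnitFlow

open Fin.NatCast Fin.CommRing in
/-- A nonempty subset of a directed cycle that is closed under succession is the whole cycle. -/
theorem IsDirectedCycle.subset_of_closed {G : MultiDigraph} {C T : Set G.E}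
    (hC : G.IsDirectedCycle C) (hT : T ⊆ C) (hne : T.Nonempty)
    (hcl : ∀ x ∈ T, ∃ y ∈ T, G.src y = G.tgt x) : C = T := by
  refine Set.Subset.antisymm ?_ hT
  have hinj := hC.src_injOn
  obtain ⟨m, c, hc, ht, rfl⟩ := hC
  obtain ⟨x, hx⟩ := hne
  obtain ⟨j, rfl⟩ := hT hx
  have key : ∀ k : ℕ, c (j + (k : Fin (m + 1))) ∈ T := by
    intro k
    induction k with
    | zero => simpa using hx
    | succ k ih =>
      obtain ⟨y, hy, hyk⟩ := hcl _ ih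
      rw [ht] at hyk
      have := hinj (hT hy) ⟨_, rfl⟩ hyk
      rw [Nat.cast_succ, ← add_assoc, ← this]
      exact hy
  rintro _ ⟨i, rfl⟩
  have := key (i - j).val
  rwa [Fin.cast_val_eq_self, add_sub_cancel] at this

theorem val_add_two_sub (hn : 5 ≤ n) (i m : ZMod n) :
    (m + 2 - i).val = (m - i).val + 2 ∨ (m + 2 - i).val + n = (m - i).val + 2 := by
  have h1 : m + 2 - i = (m - i) + 2 := by ring
  have h2 : (2 : ZMod n).val = 2 := ZMod.val_natCast_of_lt (n := n) (a := 2) (by omega)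
  rw [h1]
  rcases lt_or_ge ((m - i).val + (2 : ZMod n).val) n with h | h
  · left
    rw [ZMod.val_add_of_lt h, h2]
  · right
    have := ZMod.val_add_val_of_le h
    omega

theorem val_sub_one_sub (hn : 5 ≤ n) (i m : ZMod n) :
    (m - 1 - i).val + 1 = (m - i).val ∨ (m - i).val = 0 ∧ (m - 1 - i).val + 1 = n := by
  have h1 : m - i = (m - 1 - i) + 1 := by ring
  have h2 : (1 : ZMod n).val = 1 := ZMod.val_one'' (by omega)
  have h3 := ZMod.val_lt (m - 1 - i)
  rcases lt_or_ge ((m - 1 - i).val + (1 : ZMod n).val) n with h | h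
  · left
    rw [h1, ZMod.val_add_of_lt h, h2]
  · right
    have := ZMod.val_add_val_of_le h
    rw [← h1] at this
    omega

theorem false_mem_triangle (hn : 5 ≤ n) (i m : ZMod n) :
    (m, false) ∈ triangle i ↔ (m - i).val = 1 ∨ (m - i).val = 2 := by
  have h2 : (2 : ZMod n).val = 2 := ZMod.val_natCast_of_lt (n := n) (a := 2) (by omega)
  have h1 : (1 : ZMod n).val = 1 := ZMod.val_one'' (by omega)
  have h3 : m = i + 2 ↔ (m - i).val = 2 := by
    rw [← h2, (ZMod.val_injective n).eq_iff, sub_eq_iff_eq_add']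
  have h4 : m = i + 1 ↔ (m - i).val = 1 := by
    rw [← h1, (ZMod.val_injective n).eq_iff, sub_eq_iff_eq_add']
  simp only [triangle, Set.mem_insert_iff, Set.mem_singleton_iff, Prod.mk.injEq, and_true,
    Bool.false_eq_true, and_false, false_or, h3, h4]
  tauto

end MultiDigraph

/-! ### The embedding without a triangle, and the case distinction -/

namespace MultiDigraph

variable {n : ℕ}

theorem ncard_triangle (hn : 5 ≤ n) (i : ZMod n) : (triangle i).ncard = 3 := by
  rw [Set.ncard_eq_three]
  have h2 : (2 : ZMod n).val = 2 := ZMod.val_natCast_of_lt (n := n) (a := 2) (by omega)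
  have h1 : (1 : ZMod n).val = 1 := ZMod.val_one'' (by omega)
  refine ⟨_, _, _, ?_, ?_, ?_, rfl⟩
  · simp
  · simp
  · intro h
    have : (2 : ZMod n) = 1 := add_left_cancel (congrArg Prod.fst h)
    rw [this] at h2
    omega

variable [NeZero n]

theorem visits_triangle (hn : 5 ≤ n) (i w : ZMod n) :
    Visits (triangle i) w ↔ (w - i).val ≤ 2 := by
  unfold Visits
  rw [true_mem_triangle, false_mem_triangle hn]
  omega

theorem goesStraight_triangle (hn : 5 ≤ n) (i w : ZMod n) :
    GoesStraight (triangle i) w ↔ (w - i).val = 1 := by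
  unfold GoesStraight
  rw [true_mem_triangle, true_mem_triangle, false_mem_triangle hn, false_mem_triangle hn]
  have h1 := val_add_two_sub hn i (w - 2)
  have h2 := val_sub_one_sub hn i (w + 1)
  rw [sub_add_cancel] at h1
  rw [add_sub_cancel_right] at h2
  omega

theorem turnAt_triangle (hn : 5 ≤ n) (i : ZMod n) (f : ZMod n → Bool) (w : ZMod n) :
    turnAt (triangle i) f w = if (w - i).val ≤ 2 then decide ((w - i).val ≠ 1) else f w := by
  simp only [turnAt, visits_triangle hn, goesStraight_triangle hn, ne_eq]

/-- The facial walks of one orientation in the embedding without a triangle. -/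
def evenLabel (n : ℕ) (b : Bool) (v : ℕ) : ℕ :=
  if b then if v % 2 = 0 ∧ 2 ≤ v ∧ v + 3 ≤ n then v else 0
  else if v % 2 = 0 then v - 2 else v - 1

/-- The facial walks of the other orientation in the embedding without a triangle. -/
def oddLabel (n : ℕ) (b : Bool) (v : ℕ) : ℕ :=
  if b then if v % 2 = 1 then v else 1
  else if v = 0 then n - 2 else if v % 2 = 1 then v - 2 else v - 1

/-- The transition at the vertices outside the triangle alternates. -/
def evenTurn (i : ZMod n) (w : ZMod n) : Bool := decide ((w - i).val % 2 = 0)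

/-- Relative to `i`, the facial walks are the triangles `v → v + 2 → v + 1 → v` with `v` even, `2 ≤
v ≤ n - 3`, and the walk `0 → n - 1 → 1 → 3 → ⋯ → n - 2 → 0` with label `0`. The arc `0 → n - 1`
receives this label by truncated subtraction. -/
theorem evenLabel_turnPerm (hn : 5 ≤ n) (hodd : Odd n) (i : ZMod n) {e : ZMod n × Bool}
    (he : e ∉ triangle i) :
    evenLabel n (turnPerm (turnAt (triangle i) (evenTurn i)) e).2
      ((turnPerm (turnAt (triangle i) (evenTurn i)) e).1 - i).val =
    evenLabel n e.2 (e.1 - i).val := by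
  obtain ⟨k, hk⟩ := hodd
  have hturn : ∀ w, turnAt (triangle i) (evenTurn i) w = decide ((w - i).val % 2 = 0) := by
    intro w
    rw [turnAt_triangle hn, evenTurn]
    split_ifs with h
    · rw [decide_eq_decide]
      omega
    · rfl
  rcases e with ⟨m, _ | _⟩
  · rw [false_mem_triangle hn] at he
    rw [turnPerm_false, hturn]
    have h1 := val_sub_one_sub hn i m
    have h2 := ZMod.val_lt (m - i)
    generalize (m - 1 - i).val = x at *
    generalize (m - i).val = y at *
    by_cases hx : x % 2 = 0 <;>
      simp only [evenLabel, hx, decide_true, decide_false, if_true, Bool.false_eq_true,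
        if_false, true_and, false_and] <;>
      split_ifs <;> omega
  · rw [true_mem_triangle] at he
    rw [turnPerm_true, hturn]
    have h1 := val_add_two_sub hn i m
    have h2 := ZMod.val_lt (m - i)
    have h3 := ZMod.val_lt (m + 2 - i)
    generalize (m + 2 - i).val = x at *
    generalize (m - i).val = y at *
    by_cases hx : x % 2 = 0 <;>
      simp only [evenLabel, hx, decide_true, decide_false, if_true, Bool.false_eq_true,
        Bool.not_true, Bool.not_false, if_false, true_and, false_and] <;>
      split_ifs <;> omega

/-- Relative to `i`, the facial walks are the triangles `v → v + 2 → v + 1 → v` with `v` odd, `3 ≤ v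
≤ n - 2` (the last one passes through `0`), and the walk `1 → 3 → 2 → 4 → ⋯ → n - 1 → 1` with label
`1`. -/
theorem oddLabel_turnPerm (hn : 5 ≤ n) (hodd : Odd n) (i : ZMod n) {e : ZMod n × Bool}
    (he : e ∉ triangle i) :
    oddLabel n (turnPerm (turnAt (triangle i) fun w => !(evenTurn i w)) e).2
      ((turnPerm (turnAt (triangle i) fun w => !(evenTurn i w)) e).1 - i).val =
    oddLabel n e.2 (e.1 - i).val := by
  obtain ⟨k, hk⟩ := hodd
  have hturn : ∀ w, turnAt (triangle i) (fun w => !(evenTurn i w)) w =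
      decide ((w - i).val = 0 ∨ (w - i).val = 2 ∨ ((w - i).val ≠ 1 ∧ (w - i).val % 2 = 1)) := by
    intro w
    rw [turnAt_triangle hn, evenTurn]
    split_ifs with h
    · rw [decide_eq_decide]
      omega
    · rw [← decide_not, decide_eq_decide]
      omega
  rcases e with ⟨m, _ | _⟩
  · rw [false_mem_triangle hn] at he
    rw [turnPerm_false, hturn]
    have h1 := val_sub_one_sub hn i m
    have h2 := ZMod.val_lt (m - i)
    generalize (m - 1 - i).val = x at *
    generalize (m - i).val = y at *
    by_cases hx : x = 0 ∨ x = 2 ∨ (x ≠ 1 ∧ x % 2 = 1) <;>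
      simp only [oddLabel, hx, decide_true, decide_false, if_true, Bool.false_eq_true,
        if_false] <;>
      split_ifs <;> omega
  · rw [true_mem_triangle] at he
    rw [turnPerm_true, hturn]
    have h1 := val_add_two_sub hn i m
    have h2 := ZMod.val_lt (m - i)
    have h3 := ZMod.val_lt (m + 2 - i)
    generalize (m + 2 - i).val = x at *
    generalize (m - i).val = y at *
    by_cases hx : x = 0 ∨ x = 2 ∨ (x ≠ 1 ∧ x % 2 = 1) <;>
      simp only [oddLabel, hx, decide_true, decide_false, if_true, Bool.false_eq_true,
        Bool.not_true, Bool.not_false, if_false] <;>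
      split_ifs <;> omega

/-- The remaining arcs `m → m - 1` join `i, i - 1, …, i + 2`, and `i + 1 → i + 3` attaches the last
vertex. -/
theorem numComponents_triangle_le (hn : 5 ≤ n) (i : ZMod n) :
    ((stepDigraph n).deleteArcs (triangle i)).numComponents ≤ 1 := by
  have hval : ∀ k : ℕ, k < n → (i + (k : ZMod n) - i).val = k := fun k hk => by
    rw [add_sub_cancel_left, ZMod.val_natCast_of_lt hk]
  have hdown : ∀ k : ℕ, 2 ≤ k → k < n →
      Quot.mk (fun u v : ((stepDigraph n).deleteArcs (triangle i)).V =>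
        ∃ e, ((stepDigraph n).deleteArcs (triangle i)).src e = u ∧
          ((stepDigraph n).deleteArcs (triangle i)).tgt e = v) (i + (k : ZMod n)) =
      Quot.mk _ (i + ((2 : ℕ) : ZMod n)) := by
    intro k hk
    induction k, hk using Nat.le_induction with
    | base => exact fun _ => rfl
    | succ k hk ih =>
      intro hkn
      refine (quot_eq_of_notMem (e := (i + ((k + 1 : ℕ) : ZMod n), false)) ?_ rfl ?_).trans
        (ih (by omega))
      · rw [false_mem_triangle hn, hval _ hkn]
        omega
      · change i + ((k + 1 : ℕ) : ZMod n) - 1 = i + k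
        push_cast
        ring
  rw [numComponents, Finite.card_le_one_iff_subsingleton]
  suffices h : ∀ k : ℕ, k < n → Quot.mk (fun u v : ((stepDigraph n).deleteArcs (triangle i)).V =>
        ∃ e, ((stepDigraph n).deleteArcs (triangle i)).src e = u ∧
          ((stepDigraph n).deleteArcs (triangle i)).tgt e = v) (i + (k : ZMod n)) =
      Quot.mk _ (i + ((2 : ℕ) : ZMod n)) by
    have h' : ∀ w : ZMod n, Quot.mk (fun u v : ((stepDigraph n).deleteArcs (triangle i)).V =>
        ∃ e, ((stepDigraph n).deleteArcs (triangle i)).src e = u ∧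
          ((stepDigraph n).deleteArcs (triangle i)).tgt e = v) w =
        Quot.mk _ (i + ((2 : ℕ) : ZMod n)) := by
      intro w
      refine Eq.trans (congrArg (Quot.mk _) ?_) (h (w - i).val (ZMod.val_lt _))
      rw [ZMod.natCast_zmod_val, add_sub_cancel]
    refine ⟨?_⟩
    rintro ⟨u⟩ ⟨v⟩
    exact (h' u).trans (h' v).symm
  intro k hk
  by_cases h2 : 2 ≤ k
  · exact hdown k h2 hk
  obtain rfl | rfl : k = 0 ∨ k = 1 := by omega
  · refine (quot_eq_of_notMem (e := (i + ((0 : ℕ) : ZMod n), false)) ?_ rfl ?_).trans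
      (hdown (n - 1) (by omega) (by omega))
    · rw [false_mem_triangle hn, hval _ hk]
      omega
    · change i + ((0 : ℕ) : ZMod n) - 1 = i + ((n - 1 : ℕ) : ZMod n)
      rw [Nat.cast_sub (by omega)]
      simp
      ring
  · refine (quot_eq_of_notMem (e := (i + ((1 : ℕ) : ZMod n), true)) ?_ rfl ?_).trans
      (hdown 3 (by omega) (by omega))
    · rw [true_mem_triangle, hval _ hk]
      omega
    · change i + ((1 : ℕ) : ZMod n) + 2 = i + ((3 : ℕ) : ZMod n)
      push_cast
      ring

/-- One long walk and `k - 1` triangles per orientation give `2k = n - 1` walks, as Euler's formula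
demands of a connected plane digraph with `n` vertices and `2n - 3` arcs. -/
theorem isDiplanar_deleteArcs_triangle (hn : 5 ≤ n) (hodd : Odd n) (i : ZMod n)
    (hC : IsUnitFlow (triangle i)) : ((stepDigraph n).deleteArcs (triangle i)).IsDiplanar := by
  refine hC.isDiplanar_of_le (evenTurn i) ?_
  have h1 := numComponents_triangle_le hn i
  have h2 := ncard_triangle hn i
  have h3 : (triangle i).ncard + Nat.card {e : ZMod n × Bool // e ∉ triangle i} = 2 * n := by
    have h4 := Set.ncard_add_ncard_compl (triangle i)
    rw [Nat.card_prod, Nat.card_zmod, Nat.card_eq_fintype_card, Fintype.card_bool, mul_comm] at h4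
    rw [← h4, ← Nat.card_coe_set_eq (triangle i)ᶜ]
    rfl
  have hval : ∀ k : ℕ, k < n → (i + (k : ZMod n) - i).val = k := fun k hk => by
    rw [add_sub_cancel_left, ZMod.val_natCast_of_lt hk]
  obtain ⟨k, hk⟩ := id hodd
  have h5 := ncard_range_le_cycleCount (p := hC.transition (evenTurn i))
    (fun e : ((stepDigraph n).deleteArcs (triangle i)).E => evenLabel n e.1.2 (e.1.1 - i).val)
    fun e => evenLabel_turnPerm hn hodd i e.2
  have h6 := ncard_range_le_cycleCount (p := hC.transition fun w => !(evenTurn i w))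
    (fun e : ((stepDigraph n).deleteArcs (triangle i)).E => oddLabel n e.1.2 (e.1.1 - i).val)
    fun e => oddLabel_turnPerm hn hodd i e.2
  have h7 : k ≤ (Set.range fun e : ((stepDigraph n).deleteArcs (triangle i)).E =>
      evenLabel n e.1.2 (e.1.1 - i).val).ncard := by
    have hinj : Function.Injective fun j : ℕ => 2 * j := fun a b h => by simpa using h
    have h8 : ((fun j : ℕ => 2 * j) '' (Finset.range k : Set ℕ)).ncard = k := by
      rw [Set.ncard_image_of_injective _ hinj, Set.ncard_coe_finset, Finset.card_range]
    rw [← h8]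
    refine Set.ncard_le_ncard ?_ (Set.toFinite _)
    rintro _ ⟨j, hj, rfl⟩
    have hj' : j < k := by simpa using hj
    rcases Nat.eq_zero_or_pos j with rfl | hpos
    · refine ⟨⟨(i, false), fun h => ?_⟩, ?_⟩
      · have := (false_mem_triangle hn i i).1 h
        simp at this
      · simp [evenLabel]
    · refine ⟨⟨(i + ((2 * j : ℕ) : ZMod n), true), fun h => ?_⟩, ?_⟩
      · have := (true_mem_triangle i _).1 h
        rw [hval _ (by omega)] at this
        omega
      · dsimp only
        rw [hval _ (by omega)]
        simp only [evenLabel, if_true]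
        split_ifs <;> omega
  have h9 : k ≤ (Set.range fun e : ((stepDigraph n).deleteArcs (triangle i)).E =>
      oddLabel n e.1.2 (e.1.1 - i).val).ncard := by
    have hinj : Function.Injective fun j : ℕ => 2 * j + 1 := fun a b h => by simpa using h
    have h8 : ((fun j : ℕ => 2 * j + 1) '' (Finset.range k : Set ℕ)).ncard = k := by
      rw [Set.ncard_image_of_injective _ hinj, Set.ncard_coe_finset, Finset.card_range]
    rw [← h8]
    refine Set.ncard_le_ncard ?_ (Set.toFinite _)
    rintro _ ⟨j, hj, rfl⟩
    have hj' : j < k := by simpa using hj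
    refine ⟨⟨(i + ((2 * j + 1 : ℕ) : ZMod n), true), fun h => ?_⟩, ?_⟩
    · have := (true_mem_triangle i _).1 h
      rw [hval _ (by omega)] at this
      omega
    · dsimp only
      rw [hval _ (by omega)]
      simp only [oddLabel, if_true]
      split_ifs <;> omega
  omega

/-- A cut is crossed by two forward arcs and one backward arc, so the winding number is between `-1`
and `2`. Either extreme puts all arcs of one type into `C`, which then visits every vertex. -/
theorem isDiplanar_stepDigraph_deleteArcs (hn : 5 ≤ n) (hodd : Odd n) {C : Set (ZMod n × Bool)}
    (hcyc : (stepDigraph n).IsDirectedCycle C) : ((stepDigraph n).deleteArcs C).IsDiplanar := by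
  have hC := hcyc.isUnitFlow
  obtain ⟨t, ht⟩ := hC.exists_winding
  have hcases : t = -1 ∨ t = 0 ∨ t = 1 ∨ t = 2 := by
    have h := ht 0
    rcases mult_cases C true (0 - 1) with ⟨-, e1⟩ | ⟨-, e1⟩ <;>
    rcases mult_cases C true 0 with ⟨-, e2⟩ | ⟨-, e2⟩ <;>
    rcases mult_cases C false (0 + 1) with ⟨-, e3⟩ | ⟨-, e3⟩ <;> omega
  rcases hcases with rfl | rfl | rfl | rfl
  · refine hC.isDiplanar_of_forall_visits fun w => ?_
    have h := ht (w - 1)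
    rw [sub_add_cancel] at h
    rcases mult_cases C true (w - 1 - 1) with ⟨-, e1⟩ | ⟨-, e1⟩ <;>
    rcases mult_cases C true (w - 1) with ⟨-, e2⟩ | ⟨-, e2⟩ <;>
    rcases mult_cases C false w with ⟨h3, e3⟩ | ⟨-, e3⟩ <;>
    first | omega | exact Or.inr h3
  -- A forward arc crosses two cuts, and winding number zero demands a backward arc of `C` across
  -- each of them. This closes a triangle, which must be all of `C`.
  · have hstep : ∀ i, (i, true) ∈ C → (i + 2, false) ∈ C ∧ (i + 1, false) ∈ C := by
      intro i hi
      have h1 := ht i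
      have h2 := ht (i + 1)
      rw [add_sub_cancel_right, add_assoc, show (1 : ZMod n) + 1 = 2 by ring] at h2
      rcases mult_cases C true i with ⟨-, e1⟩ | ⟨h, -⟩
      · rcases mult_cases C true (i - 1) with ⟨-, e2⟩ | ⟨-, e2⟩ <;>
        rcases mult_cases C true (i + 1) with ⟨-, e3⟩ | ⟨-, e3⟩ <;>
        rcases mult_cases C false (i + 1) with ⟨h4, e4⟩ | ⟨-, e4⟩ <;>
        rcases mult_cases C false (i + 2) with ⟨h5, e5⟩ | ⟨-, e5⟩ <;>
        first | omega | exact ⟨h5, h4⟩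
      · exact absurd hi h
    obtain ⟨i, hi⟩ : ∃ i, (i, true) ∈ C := by
      by_contra! hc
      have hne : C.Nonempty := by
        obtain ⟨m, c, -, -, rfl⟩ := hcyc
        exact ⟨c 0, 0, rfl⟩
      obtain ⟨⟨m, _ | _⟩, hm⟩ := hne
      · have h := ht (m - 1)
        rw [sub_add_cancel] at h
        simp [mult, hc, hm] at h
      · exact hc m hm
    obtain ⟨h2, h1⟩ := hstep i hi
    have hCT : C = triangle i := by
      refine hcyc.subset_of_closed ?_ ⟨(i, true), Or.inl rfl⟩ ?_
      · rintro _ (rfl | rfl | rfl)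
        · exact hi
        · exact h2
        · exact h1
      · rintro _ (rfl | rfl | rfl)
        · exact ⟨_, Or.inr (Or.inl rfl), rfl⟩
        · refine ⟨_, Or.inr (Or.inr rfl), ?_⟩
          change i + 1 = i + 2 - 1
          ring
        · refine ⟨_, Or.inl rfl, ?_⟩
          change i = i + 1 - 1
          ring
    subst hCT
    exact isDiplanar_deleteArcs_triangle hn hodd i hC
  · exact hC.isDiplanar_of_winding_one hodd ht
  · refine hC.isDiplanar_of_forall_visits fun w => ?_
    have h := ht w
    rcases mult_cases C true (w - 1) with ⟨-, e1⟩ | ⟨-, e1⟩ <;>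
    rcases mult_cases C true w with ⟨h2, e2⟩ | ⟨-, e2⟩ <;>
    rcases mult_cases C false (w + 1) with ⟨-, e3⟩ | ⟨-, e3⟩ <;>
    first | omega | exact Or.inl h2

end MultiDigraph

/-! ### Transfer to the Cayley digraph through multiplication by two -/

namespace MultiDigraph

variable {n k : ℕ}

theorem two_mul_natCast_eq (hk : n = 2 * k + 1) : 2 * (k : ZMod n) = -1 := by
  have h : ((2 * k + 1 : ℕ) : ZMod n) = 0 := by rw [← hk, ZMod.natCast_self]
  push_cast at h
  linear_combination h

theorem one_ne_natCast (hn : 5 ≤ n) (hk : n = 2 * k + 1) : (1 : ZMod n) ≠ k := by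
  intro h
  have h1 : (k : ZMod n).val = k := ZMod.val_natCast_of_lt (by omega)
  rw [← h, ZMod.val_one'' (by omega)] at h1
  omega

/-- Multiplication by two, with inverse the multiplication by `-k`. -/
def doubleEquiv (hk : n = 2 * k + 1) : ZMod n ≃ ZMod n where
  toFun g := 2 * g
  invFun m := -k * m
  left_inv g := by linear_combination -g * two_mul_natCast_eq hk
  right_inv m := by linear_combination -m * two_mul_natCast_eq hk

/-- Multiplication by two on the tails, and the type of an arc instead of its generator. -/
def doubleArcEquiv (hn : 5 ≤ n) (hk : n = 2 * k + 1) :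
    ZMod n × ({1, (k : ZMod n)} : Set (ZMod n)) ≃ ZMod n × Bool where
  toFun a := (doubleEquiv hk a.1, decide (a.2.1 = 1))
  invFun e := ((doubleEquiv hk).symm e.1, if e.2 then ⟨1, Or.inl rfl⟩ else ⟨k, Or.inr rfl⟩)
  left_inv := by
    rintro ⟨g, s, rfl | rfl⟩
    · simp
    · simp [(one_ne_natCast hn hk).symm]
  right_inv := by
    rintro ⟨m, _ | _⟩
    · simp [(one_ne_natCast hn hk).symm]
    · simp

variable [NeZero n]

/-- The vertices of the Cayley digraph as vertices of `stepDigraph n`. -/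
def cayleyVertexEquiv (hk : n = 2 * k + 1) :
    (cayley (ZMod n) {1, (k : ZMod n)}).V ≃ (stepDigraph n).V := doubleEquiv hk

/-- The arcs of the Cayley digraph as arcs of `stepDigraph n`. -/
def cayleyArcEquiv (hn : 5 ≤ n) (hk : n = 2 * k + 1) :
    (cayley (ZMod n) {1, (k : ZMod n)}).E ≃ (stepDigraph n).E := doubleArcEquiv hn hk

theorem cayleyArcEquiv_src (hn : 5 ≤ n) (hk : n = 2 * k + 1)
    (a : (cayley (ZMod n) {1, (k : ZMod n)}).E) :
    cayleyVertexEquiv hk ((cayley (ZMod n) {1, (k : ZMod n)}).src a) =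
      (stepDigraph n).src (cayleyArcEquiv hn hk a) := rfl

theorem cayleyArcEquiv_tgt (hn : 5 ≤ n) (hk : n = 2 * k + 1)
    (a : (cayley (ZMod n) {1, (k : ZMod n)}).E) :
    cayleyVertexEquiv hk ((cayley (ZMod n) {1, (k : ZMod n)}).tgt a) =
      (stepDigraph n).tgt (cayleyArcEquiv hn hk a) := by
  rcases a with ⟨g, s, rfl | rfl⟩
  · have h : doubleArcEquiv hn hk (g, ⟨1, Or.inl rfl⟩) = (2 * g, true) :=
      Prod.ext rfl (decide_eq_true rfl)
    refine Eq.trans ?_ (congrArg (stepDigraph n).tgt h).symm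
    change 2 * (g + 1) = 2 * g + 2
    ring
  · have h : doubleArcEquiv hn hk (g, ⟨k, Or.inr rfl⟩) = (2 * g, false) :=
      Prod.ext rfl (decide_eq_false (one_ne_natCast hn hk).symm)
    refine Eq.trans ?_ (congrArg (stepDigraph n).tgt h).symm
    change 2 * (g + (k : ZMod n)) = 2 * g - 1
    linear_combination two_mul_natCast_eq hk

theorem isQuarticEulerian_stepDigraph : (stepDigraph n).IsQuarticEulerian := by
  intro (w : ZMod n)
  constructor
  · have : {e : ZMod n × Bool | (stepDigraph n).tgt e = w} = {(w - 2, true), (w + 1, false)} := by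
      ext e
      exact stepDigraph_tgt_eq_iff e w
    exact (congrArg Set.ncard this).trans (Set.ncard_pair (by simp))
  · have : {e : ZMod n × Bool | e.1 = w} = {(w, true), (w, false)} := by
      ext ⟨m, b⟩
      cases b <;> simp
    exact (congrArg Set.ncard this).trans (Set.ncard_pair (by simp))

theorem IsQuarticEulerian.of_iso {G H : MultiDigraph} (hG : G.IsQuarticEulerian)
    (fV : H.V ≃ G.V) (fE : H.E ≃ G.E) (hsrc : ∀ a, fV (H.src a) = G.src (fE a))
    (htgt : ∀ a, fV (H.tgt a) = G.tgt (fE a)) : H.IsQuarticEulerian := by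
  intro v
  suffices H.inDegree v = G.inDegree (fV v) ∧ H.outDegree v = G.outDegree (fV v) by
    rw [this.1, this.2]
    exact hG (fV v)
  unfold inDegree outDegree
  rw [← Set.ncard_image_of_injective {e | H.tgt e = v} fE.injective,
    ← Set.ncard_image_of_injective {e | H.src e = v} fE.injective]
  constructor <;>
  · congr 1
    ext e
    obtain ⟨a, rfl⟩ := fE.surjective e
    simp [← hsrc, ← htgt]

theorem isQuarticEulerian_cayley (hn : 5 ≤ n) (hk : n = 2 * k + 1) :
    (cayley (ZMod n) {1, (k : ZMod n)}).IsQuarticEulerian :=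
  isQuarticEulerian_stepDigraph.of_iso (cayleyVertexEquiv hk) (cayleyArcEquiv hn hk)
    (cayleyArcEquiv_src hn hk) (cayleyArcEquiv_tgt hn hk)

theorem not_isDiplanar_cayley (hn : 5 ≤ n) (hk : n = 2 * k + 1) :
    ¬ (cayley (ZMod n) {1, (k : ZMod n)}).IsDiplanar := by
  intro hd
  refine not_isDiplanar_stepDigraph hn ⟨k, hk⟩ (hd.of_iso (cayleyVertexEquiv hk).symm
    (cayleyVertexEquiv hk).symm.injective (cayleyArcEquiv hn hk).symm (fun e => ?_) fun e => ?_)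
  · rw [symm_apply_eq, cayleyArcEquiv_src hn hk, apply_symm_apply]
  · rw [symm_apply_eq, cayleyArcEquiv_tgt hn hk, apply_symm_apply]

theorem isDiplanar_cayley_deleteArcs (hn : 5 ≤ n) (hk : n = 2 * k + 1)
    (C : Set (cayley (ZMod n) {1, (k : ZMod n)}).E)
    (hC : (cayley (ZMod n) {1, (k : ZMod n)}).IsDirectedCycle C) :
    ((cayley (ZMod n) {1, (k : ZMod n)}).deleteArcs C).IsDiplanar := by
  have hC' : (stepDigraph n).IsDirectedCycle (cayleyArcEquiv hn hk '' C) := by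
    obtain ⟨m, c, hinj, hsucc, rfl⟩ := hC
    refine ⟨m, fun j => cayleyArcEquiv hn hk (c j), fun a b hab => hinj ?_, fun j => ?_, ?_⟩
    · exact (cayleyVertexEquiv hk).injective hab
    · rw [← cayleyArcEquiv_tgt, ← cayleyArcEquiv_src, hsucc]
    · rw [← Set.range_comp]
      rfl
  refine (isDiplanar_stepDigraph_deleteArcs hn ⟨k, hk⟩ hC').of_iso (cayleyVertexEquiv hk)
    (cayleyVertexEquiv hk).injective ((cayleyArcEquiv hn hk).subtypeEquiv fun a => ?_)
    (fun a => cayleyArcEquiv_src hn hk a.1) fun a => cayleyArcEquiv_tgt hn hk a.1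
  exact not_congr (cayleyArcEquiv hn hk).injective.mem_set_image.symm

end MultiDigraph

theorem mainTheorem4 (n k : ℕ) [NeZero n] (hn : 5 ≤ n) (hk : n = 2 * k + 1) :
    (MultiDigraph.cayley (ZMod n) {1, (k : ZMod n)}).IsDiplanarObstruction ∧
    ∀ C : Set (MultiDigraph.cayley (ZMod n) {1, (k : ZMod n)}).E,
      (MultiDigraph.cayley (ZMod n) {1, (k : ZMod n)}).IsDirectedCycle C →
        ((MultiDigraph.cayley (ZMod n) {1, (k : ZMod n)}).deleteArcs C).IsDiplanar := by
  have hquartic := MultiDigraph.isQuarticEulerian_cayley hn hk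
  have hdelete := MultiDigraph.isDiplanar_cayley_deleteArcs hn hk
  exact ⟨⟨hquartic, MultiDigraph.not_isDiplanar_cayley hn hk,
    fun _ _ h => hquartic.isDiplanar_of_strictlySmaller hdelete h⟩, hdelete⟩
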